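/- **Setting.** Let $G:\mathbb R\to\mathbb R$ be twice continuously differentiable, neither linear nor quadratic, with $E[G(N)]=0$ for $N$ standard Gaussian, and let $g=G'$. Let $x_i=\mu+z_i$ $(i\ge 1)$, where $\mu\in\mathbb R^p$ and $z_1,z_2,\dots$ are i.i.d. random vectors in $\mathbb R^p$ with independent components, at most one of them Gaussian, each with mean $0$ and variance $1$. (This is the independent component model with mixing matrix $I_p$.) Write $z_{(k)}$ for the $k$th component of $z_1$ and assume that $E[z_{(k)}^4]$ and $$\nu_k=E[G(z_{(k)})],\quad E[g(z_{(k)})],\quad \sigma_k^2=\mathrm{Var}[g(z_{(k)})],\quad \lambda_k=E[g(z_{(k)})z_{(k)}],\quad \delta_k=E[g'(z_{(k)})],\quad E[g'(z_{(k)})z_{(k)}]$$ exist for all $k$. Let $s_k=\mathrm{sign}(\nu_k)$. Assume the following regularity: for each $k$ there is $r>0$ such that $\sup\{|g'(u^Tz_1+t)|\,(1+\|z_1\|^2):\|u-e_k\|\le r,\ |t|\le r\}$ is bounded by an integrable random variable. Assume further that $\nu_k(\lambda_k-\delta_k)\ge 0$ for all $k$, with equality for at most one $k$. **Estimates.** Let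 $\bar x$ and $\hat S$ be the mean and the covariance matrix of the empirical distribution of $x_1,\dots,x_n$, and put $\hat G(\gamma)=\frac1n\sum_{i=1}^n G(\gamma^T(x_i-\bar x))$ and $\hat T(\gamma)=\frac1n\sum_{i=1}^n g(\gamma^T(x_i-\bar x))(x_i-\bar x)$. For a $p\times p$ matrix $\hat\Gamma=(\hat\gamma_1,\dots,\hat\gamma_p)^T$ with $\hat\Gamma\hat S\hat\Gamma^T=I_p$ consider the estimating equations - deflation-based: $\hat T(\hat\gamma_j)=\hat S\big(\sum_{l\le j}\hat\gamma_l\hat\gamma_l^T\big)\hat T(\hat\gamma_j)$ for all $j$; - symmetric: $\hat\gamma_l^T\hat T(\hat\gamma_j)\,\mathrm{sign}(\hat G(\hat\gamma_j))=\hat\gamma_j^T\hat T(\hat\gamma_l)\,\mathrm{sign}(\hat G(\hat\gamma_l))$ for all $j,l$; - squared symmetric: $\hat G(\hat\gamma_j)\,\hat\gamma_l^T\hat T(\hat\gamma_j)=\hat G(\hat\gamma_l)\,\hat\gamma_j^T\hat T(\hat\gamma_l)$ for all $j,l$. In each case the estimate is any sequence $\hat\Gamma=\hat\Gamma_n$ of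 random matrices that satisfies the constraint and the equations with probability tending to one and converges in probability to $I_p$. For $j\neq l$, $ASV(\hat\gamma_{jl})$ denotes the variance of the centred normal limit in distribution of $\sqrt n\,\hat\gamma_{jl}$. **Theorem.** Let $j\ne l$ and let $z_{(j)},z_{(l)}$ be non-Gaussian with $\nu_j(\lambda_j-\delta_j)\neq0$ and $\nu_l(\lambda_l-\delta_l)\ne 0$. Put $\alpha_k=(\sigma_k^2-\lambda_k^2)/(\lambda_k-\delta_k)^2$ for $k\in\{j,l\}$. Then for each of the three estimates $\sqrt n\,\hat\gamma_{jl}$ and $\sqrt n\,\hat\gamma_{lj}$ converge in distribution to centred normal laws, and $$ASV(\hat\gamma_{jl})+ASV(\hat\gamma_{lj})=\Big(\frac{\beta_j}{\beta_j+\beta_l}\Big)^2(2\alpha_j+1)+\Big(\frac{\beta_l}{\beta_j+\beta_l}\Big)^2(2\alpha_l+1),$$ where - deflation-based, with $j<l$ (component $j$ is extracted before component $l$) and $\lambda_k\ne\delta_k$ for all $k<j$: $\beta_j=1$, $\beta_l=0$; - symmetric, provided that $\lambda_k=\delta_k$ for any $k$ with $\nu_k=0$: $\beta_j=s_j(\lambda_j-\delta_j)$,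 $\beta_l=s_l(\lambda_l-\delta_l)$; - squared symmetric: $\beta_j=\nu_j(\lambda_j-\delta_j)$, $\beta_l=\nu_l(\lambda_l-\delta_l)$. -/

import Mathlib

open MeasureTheory ProbabilityTheory Filter Topology
open scoped Matrix NNReal

namespace FastICA

/-! ### The nonlinearity -/

/-- The function `G` of the FastICA objective: twice continuously differentiable, neither linear nor
quadratic, and with mean zero under the standard Gaussian law.  The nonlinearity is `g = deriv G`. -/
structure IsContrast (G : ℝ → ℝ) : Prop where
  contDiff : ContDiff ℝ 2 G
  nonquadratic : ¬ ∃ a b c : ℝ, ∀ y, G y = a * y ^ 2 + b * y + c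
  gaussian_integrable : Integrable G (gaussianReal 0 1)
  gaussian_mean : ∫ y, G y ∂(gaussianReal 0 1) = 0

/-! ### Population quantities of one component `Y` -/

section Population

variable {Ω : Type*} [MeasurableSpace Ω]

/-- `ν = E[G(Y)]`. -/
noncomputable def nu (P : Measure Ω) (G : ℝ → ℝ) (Y : Ω → ℝ) : ℝ := ∫ ω, G (Y ω) ∂P

/-- `σ² = Var[g(Y)]`. -/
noncomputable def sigmaSq (P : Measure Ω) (G : ℝ → ℝ) (Y : Ω → ℝ) : ℝ :=
  variance (fun ω => deriv G (Y ω)) P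

/-- `λ = E[g(Y) Y]`. -/
noncomputable def lam (P : Measure Ω) (G : ℝ → ℝ) (Y : Ω → ℝ) : ℝ := ∫ ω, deriv G (Y ω) * Y ω ∂P

/-- `δ = E[g'(Y)]`. -/
noncomputable def del (P : Measure Ω) (G : ℝ → ℝ) (Y : Ω → ℝ) : ℝ :=
  ∫ ω, deriv (deriv G) (Y ω) ∂P

/-- `α = (σ² - λ²) / (λ - δ)²`. -/
noncomputable def alpha (P : Measure Ω) (G : ℝ → ℝ) (Y : Ω → ℝ) : ℝ :=
  (sigmaSq P G Y - lam P G Y ^ 2) / (lam P G Y - del P G Y) ^ 2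

/-- `s = sign ν`. -/
noncomputable def sgn (P : Measure Ω) (G : ℝ → ℝ) (Y : Ω → ℝ) : ℝ := Real.sign (nu P G Y)

/-- `Y` has a Gaussian law. -/
def IsGaussianVar (P : Measure Ω) (Y : Ω → ℝ) : Prop :=
  ∃ (m : ℝ) (v : ℝ≥0), P.map Y = gaussianReal m v

/-! ### The independent component model -/

/-- The latent vectors `z 0, z 1, …` form a random sample. -/
structure IsIIDSample {p : ℕ} (P : Measure Ω) (z : ℕ → Ω → Fin p → ℝ) : Prop where
  measurable : ∀ i, Measurable (z i)
  indep : iIndepFun z P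
  identDistrib : ∀ i, IdentDistrib (z i) (z 0) P P

/-- The latent vector has independent components, at most one of them Gaussian, each with mean zero
and variance one. -/
structure IsSource {p : ℕ} (P : Measure Ω) (Z : Ω → Fin p → ℝ) : Prop where
  indep : iIndepFun (fun (k : Fin p) (ω : Ω) => Z ω k) P
  atMostOneGaussian : ∀ k k' : Fin p,
    IsGaussianVar P (fun ω => Z ω k) → IsGaussianVar P (fun ω => Z ω k') → k = k'
  mean_zero : ∀ k, ∫ ω, Z ω k ∂P = 0
  second_moment : ∀ k, ∫ ω, Z ω k ^ 2 ∂P = 1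

/-- Existence of the moments of the components: `E[Y⁴]`, `E[G(Y)]`, `E[g(Y)]`, `Var[g(Y)]`,
`E[g(Y) Y]`, `E[g'(Y)]` and `E[g'(Y) Y]`. -/
structure HasMoments {p : ℕ} (P : Measure Ω) (G : ℝ → ℝ) (Z : Ω → Fin p → ℝ) : Prop where
  fourth : ∀ k, Integrable (fun ω => Z ω k ^ 4) P
  contrast : ∀ k, Integrable (fun ω => G (Z ω k)) P
  nonlin : ∀ k, MemLp (fun ω => deriv G (Z ω k)) 2 P
  nonlin_mul : ∀ k, Integrable (fun ω => deriv G (Z ω k) * Z ω k) P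
  deriv_nonlin : ∀ k, Integrable (fun ω => deriv (deriv G) (Z ω k)) P
  deriv_nonlin_mul : ∀ k, Integrable (fun ω => deriv (deriv G) (Z ω k) * Z ω k) P

/-- Regularity behind the first order Taylor expansion of the estimating equations: for every `k`
and some `r > 0`, the supremum of `|g'(uᵀZ + t)| (1 + ‖Z‖²)` over `‖u - e_k‖ ≤ r`, `|t| ≤ r` is
bounded by an integrable variable. -/
def LocallyDominated {p : ℕ} (P : Measure Ω) (G : ℝ → ℝ) (Z : Ω → Fin p → ℝ) : Prop :=
  ∀ k : Fin p, ∃ r > 0, ∃ M : Ω → ℝ, Integrable M P ∧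
    ∀ᵐ ω ∂P, ∀ (u : Fin p → ℝ) (t : ℝ), ‖u - Pi.single k 1‖ ≤ r → |t| ≤ r →
      |deriv (deriv G) (u ⬝ᵥ Z ω + t)| * (1 + ‖Z ω‖ ^ 2) ≤ M ω

end Population

/-! ### The three estimates, computed from the first `n` terms of a data sequence `x` -/

section Sample

variable {p : ℕ}

/-- The sample mean. -/
noncomputable def sampleMean (n : ℕ) (x : ℕ → Fin p → ℝ) : Fin p → ℝ :=
  (n : ℝ)⁻¹ • ∑ i ∈ Finset.range n, x i

/-- The sample covariance matrix (the covariance matrix of the empirical distribution). -/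
noncomputable def sampleCov (n : ℕ) (x : ℕ → Fin p → ℝ) : Matrix (Fin p) (Fin p) ℝ :=
  (n : ℝ)⁻¹ • ∑ i ∈ Finset.range n,
    Matrix.vecMulVec (x i - sampleMean n x) (x i - sampleMean n x)

/-- Sample version of `E[G(γᵀ(x - E x))]`. -/
noncomputable def sampleG (G : ℝ → ℝ) (n : ℕ) (x : ℕ → Fin p → ℝ) (γ : Fin p → ℝ) : ℝ :=
  (n : ℝ)⁻¹ * ∑ i ∈ Finset.range n, G (γ ⬝ᵥ (x i - sampleMean n x))

/-- Sample version of `T(γ) = E[g(γᵀ(x - E x)) (x - E x)]`. -/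
noncomputable def sampleT (G : ℝ → ℝ) (n : ℕ) (x : ℕ → Fin p → ℝ) (γ : Fin p → ℝ) : Fin p → ℝ :=
  (n : ℝ)⁻¹ • ∑ i ∈ Finset.range n,
    deriv G (γ ⬝ᵥ (x i - sampleMean n x)) • (x i - sampleMean n x)

/-- Sample version of `T₂(γ) = E[G(γᵀ(x - E x))] E[g(γᵀ(x - E x)) (x - E x)]`. -/
noncomputable def sampleT2 (G : ℝ → ℝ) (n : ℕ) (x : ℕ → Fin p → ℝ) (γ : Fin p → ℝ) : Fin p → ℝ :=
  sampleG G n x γ • sampleT G n x γ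

/-- The constraint `Γ Ŝ Γᵀ = I`, that is, `γ_lᵀ Ŝ γ_j = δ_lj` for the rows `γ_j` of `Γ`. -/
def IsWhitening (n : ℕ) (x : ℕ → Fin p → ℝ) (Γ : Matrix (Fin p) (Fin p) ℝ) : Prop :=
  Γ * sampleCov n x * Γᵀ = 1

/-- `Γ` solves the deflation-based estimating equations; the rows are extracted in the order
`0, 1, …, p - 1`, under the orthonormality constraint. -/
def IsDeflation (G : ℝ → ℝ) (n : ℕ) (x : ℕ → Fin p → ℝ) (Γ : Matrix (Fin p) (Fin p) ℝ) : Prop :=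
  IsWhitening n x Γ ∧
    ∀ j, sampleT G n x (Γ j) =
      (sampleCov n x * ∑ l ∈ Finset.Iic j, Matrix.vecMulVec (Γ l) (Γ l)) *ᵥ sampleT G n x (Γ j)

/-- `Γ` solves the symmetric estimating equations. -/
def IsSymmetric (G : ℝ → ℝ) (n : ℕ) (x : ℕ → Fin p → ℝ) (Γ : Matrix (Fin p) (Fin p) ℝ) : Prop :=
  IsWhitening n x Γ ∧
    ∀ j l, (Γ l ⬝ᵥ sampleT G n x (Γ j)) * Real.sign (sampleG G n x (Γ j)) =
      (Γ j ⬝ᵥ sampleT G n x (Γ l)) * Real.sign (sampleG G n x (Γ l))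

/-- `Γ` solves the squared symmetric estimating equations. -/
def IsSquaredSymmetric (G : ℝ → ℝ) (n : ℕ) (x : ℕ → Fin p → ℝ)
    (Γ : Matrix (Fin p) (Fin p) ℝ) : Prop :=
  IsWhitening n x Γ ∧
    ∀ j l, Γ l ⬝ᵥ sampleT2 G n x (Γ j) = Γ j ⬝ᵥ sampleT2 G n x (Γ l)

end Sample

/-! ### Consistent sequences of estimates and asymptotic variances -/

section Asymptotics

variable {Ω : Type*} [MeasurableSpace Ω]

/-- `Γhat n` are random matrices that solve the estimating equations `Eqs` for the first `n`
observations with probability tending to one, and that converge in probability to the identity. -/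
structure IsConsistentSolution {p : ℕ} (P : Measure Ω)
    (Eqs : ℕ → (ℕ → Fin p → ℝ) → Matrix (Fin p) (Fin p) ℝ → Prop) (x : ℕ → Ω → Fin p → ℝ)
    (Γhat : ℕ → Ω → Matrix (Fin p) (Fin p) ℝ) : Prop where
  measurable : ∀ n a b, Measurable (fun ω => Γhat n ω a b)
  solves : Tendsto (fun n => P {ω | ¬ Eqs n (fun i => x i ω) (Γhat n ω)}) atTop (𝓝 0)
  consistent : ∀ a b, TendstoInMeasure P (fun n ω => Γhat n ω a b) atTop
    (fun _ => (1 : Matrix (Fin p) (Fin p) ℝ) a b)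

/-- `√n (est n - θ)` converges in distribution to `N(0, V)`. -/
def HasASV (P : Measure Ω) [IsProbabilityMeasure P] (est : ℕ → Ω → ℝ) (θ : ℝ) (V : ℝ≥0) : Prop :=
  TendstoInDistribution (fun (n : ℕ) (ω : Ω) => √(n : ℝ) * (est n ω - θ)) atTop
    (id : ℝ → ℝ) (fun _ => P) (gaussianReal 0 V)

/-- The entries `(j, l)` and `(l, j)` of `Γhat`, as estimates of the entries of the identity matrix,
have asymptotic variances whose sum is `c`. -/
def HasASVSum {p : ℕ} (P : Measure Ω) [IsProbabilityMeasure P]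
    (Γhat : ℕ → Ω → Matrix (Fin p) (Fin p) ℝ) (j l : Fin p) (c : ℝ) : Prop :=
  ∃ V W : ℝ≥0,
    HasASV P (fun n ω => Γhat n ω j l) ((1 : Matrix (Fin p) (Fin p) ℝ) j l) V ∧
    HasASV P (fun n ω => Γhat n ω l j) ((1 : Matrix (Fin p) (Fin p) ℝ) l j) W ∧
    (V : ℝ) + (W : ℝ) = c

end Asymptotics

/-- `(b_j/(b_j+b_l))² (2α_j+1) + (b_l/(b_j+b_l))² (2α_l+1)`. -/
noncomputable def weighted (bj bl αj αl : ℝ) : ℝ :=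
  (bj / (bj + bl)) ^ 2 * (2 * αj + 1) + (bl / (bj + bl)) ^ 2 * (2 * αl + 1)

end FastICA

open FastICA

/-!
Convergence in probability is convergence along a filter on `ℕ × Ω`, so the stochastic orders `o_P`
and `O_P` are ordinary Landau symbols along that filter. A Taylor expansion of `T̂` around the
unit vectors, in which independence annihilates all derivatives but one, gives
`T̂(γ_j)_l ≈ Q_jl + δ_j Γ_jl` for `j ≠ l`, with `Q_jl` a centred empirical mean. The constraint
`Γ Ŝ Γᵀ = 1` gives `Γ_jl + Γ_lj ≈ -(Ŝ - 1)_jl`. To first order each estimating equation is therefore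
a linear equation in `(Γ_jl, Γ_lj)`, and both entries are empirical means of combinations of
`(g(z_j) - E[g(z_j)] - λ_j z_j) z_l`, of the same term with `j` and `l` exchanged, and of `z_j z_l`.
These three are orthogonal, so the central limit theorem yields the asymptotic variances.
The remainders are first relative to the unknown size of `Γ - 1`; the equations themselves then
bound that size by `n ^ (-1/2)`.
-/

namespace FastICA

open Asymptotics

/-! ### Stochastic order symbols as order symbols along a filter -/

section ProbFilter

variable {Ω : Type*} [MeasurableSpace Ω] {P : Measure Ω}

/-- The filter of the sequences of events whose probability tends to one. Convergence in
probability is convergence along this filter. -/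
def probFilter (P : Measure Ω) : Filter (ℕ × Ω) where
  sets := {A | Tendsto (fun n => P {ω | (n, ω) ∉ A}) atTop (𝓝 0)}
  univ_sets := by simp
  sets_of_superset := by
    intro A B hA hAB
    exact tendsto_of_tendsto_of_tendsto_of_le_of_le tendsto_const_nhds hA (fun _ => zero_le)
      (fun n => measure_mono fun ω hω h => hω (hAB h))
  inter_sets := by
    intro A B hA hB
    have h : Tendsto (fun n => P {ω | (n, ω) ∉ A} + P {ω | (n, ω) ∉ B}) atTop (𝓝 0) := by
      simpa using Tendsto.add hA hB
    refine tendsto_of_tendsto_of_tendsto_of_le_of_le tendsto_const_nhds h (fun _ => zero_le)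
      (fun n => (measure_mono ?_).trans (measure_union_le _ _))
    intro ω hω
    by_cases h : (n, ω) ∈ A
    · exact Or.inr fun h' => hω ⟨h, h'⟩
    · exact Or.inl h

theorem eventually_probFilter {C : ℕ × Ω → Prop} :
    (∀ᶠ q in probFilter P, C q) ↔ Tendsto (fun n => P {ω | ¬ C (n, ω)}) atTop (𝓝 0) :=
  Iff.rfl

theorem tendsto_fst_probFilter : Tendsto Prod.fst (probFilter P) atTop := by
  intro A hA
  obtain ⟨N, hN⟩ := mem_atTop_sets.1 hA
  refine eventually_probFilter.2 (tendsto_const_nhds.congr' ?_)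
  filter_upwards [eventually_ge_atTop N] with n hn
  simp [hN n hn]

theorem tendstoInMeasure_iff_probFilter {E : Type*} [SeminormedAddCommGroup E] {f : ℕ → Ω → E}
    {g : Ω → E} :
    TendstoInMeasure P f atTop g ↔
      Tendsto (fun q : ℕ × Ω => f q.1 q.2 - g q.2) (probFilter P) (𝓝 0) := by
  rw [tendstoInMeasure_iff_norm, Metric.tendsto_nhds]
  simp only [eventually_probFilter, dist_zero_right, not_lt]

theorem eventually_pos_probFilter : ∀ᶠ q in probFilter P, 0 < (q.1 : ℝ) := by
  filter_upwards [tendsto_fst_probFilter.eventually (eventually_gt_atTop 0)] with q hq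
  exact_mod_cast hq

theorem tendsto_inv_sqrt_probFilter :
    Tendsto (fun q : ℕ × Ω => (√(q.1 : ℝ))⁻¹) (probFilter P) (𝓝 0) :=
  (tendsto_inv_atTop_zero.comp
    (Real.tendsto_sqrt_atTop.comp tendsto_natCast_atTop_atTop)).comp tendsto_fst_probFilter

/-- Boundedness in probability, encoded as the property that is used: products with variables that
tend to zero in probability tend to zero in probability. -/
def Tight (P : Measure Ω) (R : ℕ × Ω → ℝ) : Prop :=
  ∀ Y : ℕ × Ω → ℝ, Tendsto Y (probFilter P) (𝓝 0) →
    Tendsto (fun q => Y q * R q) (probFilter P) (𝓝 0)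

theorem Tight.abs {R : ℕ × Ω → ℝ} (hR : Tight P R) : Tight P fun q => |R q| := fun Y hY => by
  rw [tendsto_zero_iff_abs_tendsto_zero]
  simpa [Function.comp_def, abs_mul] using (hR Y hY).abs

theorem Tight.sum {ι : Type*} (s : Finset ι) {R : ι → ℕ × Ω → ℝ} (hR : ∀ i ∈ s, Tight P (R i)) :
    Tight P fun q => ∑ i ∈ s, R i q := fun Y hY => by
  simpa [Finset.mul_sum] using tendsto_finsetSum s fun i hi => hR i hi Y hY

theorem tight_of_uniform_tail_le {R : ℕ × Ω → ℝ}
    (hR : ∀ η : ENNReal, 0 < η → ∃ K > 0, ∀ n, P {ω | K ≤ |R (n, ω)|} ≤ η) : Tight P R := by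
  intro Y hY
  rw [Metric.tendsto_nhds]
  intro ε hε
  simp only [dist_zero_right, Real.norm_eq_abs, abs_mul]
  rw [eventually_probFilter, ENNReal.tendsto_nhds_zero]
  intro η hη
  have hη2 : 0 < η / 2 := ENNReal.half_pos hη.ne'
  obtain ⟨K, hK, hRK⟩ := hR (η / 2) hη2
  have hYK : ∀ᶠ q in probFilter P, |Y q| < ε / K := by
    simpa using (Metric.tendsto_nhds.1 hY) (ε / K) (by positivity)
  rw [eventually_probFilter, ENNReal.tendsto_nhds_zero] at hYK
  filter_upwards [hYK (η / 2) hη2] with n hn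
  calc P {ω | ¬ |Y (n, ω)| * |R (n, ω)| < ε}
      ≤ P ({ω | ¬ |Y (n, ω)| < ε / K} ∪ {ω | K ≤ |R (n, ω)|}) := by
        refine measure_mono fun ω hω => ?_
        by_contra hcon
        simp only [Set.mem_union, Set.mem_ofPred_eq, not_or, not_not, not_le] at hcon hω
        apply hω
        calc |Y (n, ω)| * |R (n, ω)| ≤ |Y (n, ω)| * K := by gcongr; exact hcon.2.le
          _ < ε / K * K := by gcongr; exact hcon.1
          _ = ε := by field_simp
    _ ≤ η / 2 + η / 2 := (measure_union_le _ _).trans (add_le_add hn (hRK n))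
    _ = η := ENNReal.add_halves η

theorem tight_of_variance_le [IsFiniteMeasure P] {R : ℕ × Ω → ℝ} {C : ℝ}
    (hR : ∀ n, MemLp (fun ω => R (n, ω)) 2 P) (hmean : ∀ n, ∫ ω, R (n, ω) ∂P = 0)
    (hC : ∀ n, variance (fun ω => R (n, ω)) P ≤ C) : Tight P R := by
  refine tight_of_uniform_tail_le fun η hη => ?_
  have hlim : Tendsto (fun K : ℝ => ENNReal.ofReal (C / K ^ 2)) atTop (𝓝 0) := by
    simpa using ENNReal.tendsto_ofReal
      (tendsto_const_nhds (x := C).div_atTop (tendsto_pow_atTop (α := ℝ) two_ne_zero))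
  obtain ⟨K, hKη, hK⟩ :=
    ((ENNReal.tendsto_nhds_zero.1 hlim η hη).and (eventually_gt_atTop 0)).exists
  refine ⟨K, hK, fun n => le_trans ?_ hKη⟩
  have hchebyshev := meas_ge_le_variance_div_sq (hR n) hK
  simp only [hmean n, sub_zero] at hchebyshev
  exact hchebyshev.trans (ENNReal.ofReal_le_ofReal (by gcongr; exact hC n))

/-- A rate `ρ` at which finitely many root-`n` consistent sequences vanish, chosen such that
`o(ρ)` still means `o(1 / √n)`. -/
theorem exists_rate {ι : Type*} [Finite ι] {f : ι → ℕ × Ω → ℝ}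
    (hf : ∀ i, Tight P fun q => √(q.1 : ℝ) * f i q) :
    ∃ ρ : ℕ × Ω → ℝ, (∀ i, f i =O[probFilter P] ρ) ∧ Tendsto ρ (probFilter P) (𝓝 0) ∧
      ∀ h : ℕ × Ω → ℝ, h =o[probFilter P] ρ →
        Tendsto (fun q => √(q.1 : ℝ) * h q) (probFilter P) (𝓝 0) := by
  cases nonempty_fintype ι
  let R : ℕ × Ω → ℝ := fun q => ∑ i, |√(q.1 : ℝ) * f i q|
  have hR : Tight P R := Tight.sum _ fun i _ => (hf i).abs
  have hsqrt : ∀ᶠ q in probFilter P, √(q.1 : ℝ) ≠ 0 := by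
    filter_upwards [eventually_pos_probFilter] with q hq using (Real.sqrt_pos.2 hq).ne'
  have hrate : R =ᶠ[probFilter P] fun q => √(q.1 : ℝ) * ((√(q.1 : ℝ))⁻¹ * R q) := by
    filter_upwards [hsqrt] with q hq using (mul_inv_cancel_left₀ hq _).symm
  refine ⟨fun q => (√(q.1 : ℝ))⁻¹ * R q, fun i => ?_, hR _ tendsto_inv_sqrt_probFilter,
    fun h hh => ?_⟩
  · have hle : (fun q : ℕ × Ω => √(q.1 : ℝ) * f i q) =O[probFilter P] R :=
      IsBigO.of_bound' (Eventually.of_forall fun q => (Finset.single_le_sum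
        (f := fun i => |√(q.1 : ℝ) * f i q|) (fun _ _ => abs_nonneg _)
        (Finset.mem_univ i)).trans (le_abs_self _))
    refine ((isBigO_refl (fun q : ℕ × Ω => (√(q.1 : ℝ))⁻¹) _).mul hle).congr' ?_ .rfl
    filter_upwards [hsqrt] with q hq using inv_mul_cancel_left₀ hq _
  · have hlittle : (fun q : ℕ × Ω => √(q.1 : ℝ) * h q) =o[probFilter P] R :=
      ((isBigO_refl (fun q : ℕ × Ω => √(q.1 : ℝ)) _).mul_isLittleO hh).congr' .rfl hrate.symm
    obtain ⟨φ, hφ, hφR⟩ := hlittle.exists_eq_mul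
    exact (hR φ hφ).congr' hφR.symm

end ProbFilter

/-! ### Empirical means -/

section HasMean

variable {Ω : Type*} [MeasurableSpace Ω] {P : Measure Ω} {X Y : Ω → ℝ} {a b : ℝ}

/-- `X` has expectation `a`; in contrast to the equation `∫ ω, X ω ∂P = a`, this includes the
existence of the expectation. -/
def HasMean (P : Measure Ω) (X : Ω → ℝ) (a : ℝ) : Prop :=
  Integrable X P ∧ ∫ ω, X ω ∂P = a

theorem HasMean.add (hX : HasMean P X a) (hY : HasMean P Y b) :
    HasMean P (fun ω => X ω + Y ω) (a + b) :=
  ⟨hX.1.add hY.1, by rw [integral_add hX.1 hY.1, hX.2, hY.2]⟩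

theorem HasMean.sub (hX : HasMean P X a) (hY : HasMean P Y b) :
    HasMean P (fun ω => X ω - Y ω) (a - b) :=
  ⟨hX.1.sub hY.1, by rw [integral_sub hX.1 hY.1, hX.2, hY.2]⟩

theorem HasMean.const_mul (hX : HasMean P X a) (c : ℝ) : HasMean P (fun ω => c * X ω) (c * a) :=
  ⟨hX.1.const_mul c, by rw [integral_const_mul, hX.2]⟩

theorem hasMean_const [IsProbabilityMeasure P] (c : ℝ) : HasMean P (fun _ => c) c :=
  ⟨integrable_const c, by simp⟩

theorem HasMean.mul_of_indepFun (hX : HasMean P X a) (hY : HasMean P Y b) (h : IndepFun X Y P) :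
    HasMean P (fun ω => X ω * Y ω) (a * b) :=
  ⟨h.integrable_mul hX.1 hY.1, by
    rw [h.integral_fun_mul_eq_mul_integral hX.1.aestronglyMeasurable hY.1.aestronglyMeasurable,
      hX.2, hY.2]⟩

theorem HasMean.congr (hX : HasMean P X a) (hXY : ∀ ω, X ω = Y ω) (hab : a = b) :
    HasMean P Y b := by
  obtain rfl : X = Y := funext hXY
  exact hab ▸ hX

end HasMean

section EmpMean

variable {Ω E : Type*}

/-- The mean of `ψ` under the empirical distribution of the first `n` terms of the sequence `z`, as
a function of the pair `(n, ω)` on which `probFilter` lives. -/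
noncomputable def empMean (z : ℕ → Ω → E) (ψ : E → ℝ) (q : ℕ × Ω) : ℝ :=
  (q.1 : ℝ)⁻¹ * ∑ i ∈ Finset.range q.1, ψ (z i q.2)

section Algebra

variable {z : ℕ → Ω → E}

theorem empMean_add (φ ψ : E → ℝ) (q : ℕ × Ω) :
    empMean z (fun v => φ v + ψ v) q = empMean z φ q + empMean z ψ q := by
  simp [empMean, Finset.sum_add_distrib, mul_add]

theorem empMean_sub (φ ψ : E → ℝ) (q : ℕ × Ω) :
    empMean z (fun v => φ v - ψ v) q = empMean z φ q - empMean z ψ q := by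
  simp [empMean, Finset.sum_sub_distrib, mul_sub]

theorem empMean_const_mul (c : ℝ) (ψ : E → ℝ) (q : ℕ × Ω) :
    empMean z (fun v => c * ψ v) q = c * empMean z ψ q := by
  simp [empMean, ← Finset.mul_sum, mul_left_comm]

theorem empMean_const {q : ℕ × Ω} (hq : 0 < (q.1 : ℝ)) (c : ℝ) :
    empMean z (fun _ => c) q = c := by
  simp only [empMean, Finset.sum_const, Finset.card_range, nsmul_eq_mul]
  field_simp

theorem empMean_sum {ι : Type*} (s : Finset ι) (ψ : ι → E → ℝ) (q : ℕ × Ω) :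
    empMean z (fun v => ∑ m ∈ s, ψ m v) q = ∑ m ∈ s, empMean z (ψ m) q := by
  simp only [empMean, Finset.mul_sum]
  rw [Finset.sum_comm]

theorem abs_empMean_le {φ ψ : E → ℝ} {q : ℕ × Ω}
    (h : ∀ i < q.1, |φ (z i q.2)| ≤ ψ (z i q.2)) : |empMean z φ q| ≤ empMean z ψ q := by
  rw [empMean, empMean, abs_mul, abs_of_nonneg (by positivity : 0 ≤ (q.1 : ℝ)⁻¹)]
  gcongr
  exact (Finset.abs_sum_le_sum_abs _ _).trans
    (Finset.sum_le_sum fun i hi => h i (Finset.mem_range.1 hi))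

end Algebra

variable [MeasurableSpace Ω] {P : Measure Ω}

theorem memLp_empMean {z : ℕ → Ω → E} {ψ : E → ℝ}
    {r : ENNReal} (hψ : ∀ i, MemLp (fun ω => ψ (z i ω)) r P) (n : ℕ) :
    MemLp (fun ω => empMean z ψ (n, ω)) r P := by
  simpa only [empMean] using (memLp_finsetSum (Finset.range n) fun i _ => hψ i).const_mul (n : ℝ)⁻¹

variable {p : ℕ} {z : ℕ → Ω → Fin p → ℝ} {ψ : (Fin p → ℝ) → ℝ}

theorem IsIIDSample.identDistrib_comp (hz : IsIIDSample P z) (hψ : Measurable ψ) (i : ℕ) :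
    IdentDistrib (fun ω => ψ (z i ω)) (fun ω => ψ (z 0 ω)) P P :=
  (hz.identDistrib i).comp hψ

theorem IsIIDSample.indep_comp (hz : IsIIDSample P z) (hψ : Measurable ψ) :
    iIndepFun (fun i ω => ψ (z i ω)) P :=
  hz.indep.comp (fun _ => ψ) fun _ => hψ

theorem IsIIDSample.measurable_empMean (hz : IsIIDSample P z) (hψ : Measurable ψ) (n : ℕ) :
    Measurable fun ω => empMean z ψ (n, ω) := by
  simp only [empMean]
  exact (Finset.measurable_fun_sum _ fun i _ => hψ.comp (hz.measurable i)).const_mul _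

theorem IsIIDSample.integral_empMean_eq_zero (hz : IsIIDSample P z) (hψ : Measurable ψ)
    (h0 : HasMean P (fun ω => ψ (z 0 ω)) 0) (n : ℕ) :
    ∫ ω, empMean z ψ (n, ω) ∂P = 0 := by
  simp only [empMean]
  rw [integral_const_mul,
    integral_finsetSum _ fun i _ => (hz.identDistrib_comp hψ i).integrable_iff.2 h0.1]
  simp [(hz.identDistrib_comp hψ _).integral_eq, h0.2]

theorem IsIIDSample.variance_empMean (hz : IsIIDSample P z) (hψ : Measurable ψ)
    (h2 : MemLp (fun ω => ψ (z 0 ω)) 2 P) (n : ℕ) :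
    variance (fun ω => empMean z ψ (n, ω)) P = (n : ℝ)⁻¹ * variance (fun ω => ψ (z 0 ω)) P := by
  have hsum := IndepFun.variance_sum (μ := P) (X := fun i ω => ψ (z i ω)) (s := Finset.range n)
    (fun i _ => (hz.identDistrib_comp hψ i).memLp_iff.2 h2)
    (fun i _ k _ hik => (hz.indep_comp hψ).indepFun hik)
  simp only [(hz.identDistrib_comp hψ _).variance_eq, Finset.sum_const, Finset.card_range,
    nsmul_eq_mul, Finset.sum_fn] at hsum
  simp only [empMean]
  rw [variance_const_mul, hsum]
  rcases n.eq_zero_or_pos with rfl | hn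
  · simp
  · field_simp

variable [IsProbabilityMeasure P]

/-- The weak law of large numbers. -/
theorem IsIIDSample.tendsto_empMean (hz : IsIIDSample P z) (hψ : Measurable ψ)
    {a : ℝ} (ha : HasMean P (fun ω => ψ (z 0 ω)) a) :
    Tendsto (empMean z ψ) (probFilter P) (𝓝 a) := by
  have hae := strong_law_ae (μ := P) (fun i ω => ψ (z i ω)) ha.1
    (fun i k hik => (hz.indep_comp hψ).indepFun hik) (hz.identDistrib_comp hψ)
  have hprob := tendstoInMeasure_iff_probFilter.1 (tendstoInMeasure_of_tendsto_ae
    (fun n => (hz.measurable_empMean hψ n).aestronglyMeasurable) hae)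
  simpa [ha.2] using hprob.add_const a

theorem IsIIDSample.tight_empMean (hz : IsIIDSample P z) (hψ : Measurable ψ)
    (h2 : MemLp (fun ω => ψ (z 0 ω)) 2 P) (h0 : ∫ ω, ψ (z 0 ω) ∂P = 0) :
    Tight P fun q => √(q.1 : ℝ) * empMean z ψ q := by
  refine tight_of_variance_le (C := variance (fun ω => ψ (z 0 ω)) P)
    (fun n => (memLp_empMean (fun i => (hz.identDistrib_comp hψ i).memLp_iff.2 h2) n).const_mul
      √(n : ℝ))
    (fun n => ?_) fun n => ?_
  · dsimp only
    rw [integral_const_mul, hz.integral_empMean_eq_zero hψ ⟨h2.integrable one_le_two, h0⟩,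
      mul_zero]
  · dsimp only
    rw [variance_const_mul, hz.variance_empMean hψ h2, Real.sq_sqrt n.cast_nonneg, ← mul_assoc]
    exact mul_le_of_le_one_left (variance_nonneg _ _) mul_inv_le_one

/-- The central limit theorem, combined with Slutsky's lemma. -/
theorem IsIIDSample.hasASV (hz : IsIIDSample P z) (hψ : Measurable ψ)
    (h2 : MemLp (fun ω => ψ (z 0 ω)) 2 P) (h0 : ∫ ω, ψ (z 0 ω) ∂P = 0) {est : ℕ → Ω → ℝ} {θ : ℝ}
    (hest : ∀ n, Measurable (est n))
    (h : Tendsto (fun q : ℕ × Ω => √(q.1 : ℝ) * (est q.1 q.2 - θ - empMean z ψ q)) (probFilter P)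
      (𝓝 0)) :
    HasASV P est θ (∫ ω, ψ (z 0 ω) ^ 2 ∂P).toNNReal := by
  have hvar : variance (fun ω => ψ (z 0 ω)) P = ∫ ω, ψ (z 0 ω) ^ 2 ∂P :=
    variance_of_integral_eq_zero h2.aestronglyMeasurable.aemeasurable h0
  have hclt := tendstoInDistribution_inv_sqrt_mul_sum_sub (P := P) (X := fun i ω => ψ (z i ω))
    (Y := (id : ℝ → ℝ)) (P' := gaussianReal 0 (∫ ω, ψ (z 0 ω) ^ 2 ∂P).toNNReal)
    (by rw [hvar]; exact HasLaw.id) h2 (hz.indep_comp hψ) (hz.identDistrib_comp hψ)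
  refine tendstoInDistribution_of_tendstoInMeasure_sub _ _ hclt ?_
    fun n => (((hest n).sub_const θ).const_mul _).aemeasurable
  refine tendstoInMeasure_iff_probFilter.2 (h.congr fun q => ?_)
  have hscale : (√(q.1 : ℝ))⁻¹ = √(q.1 : ℝ) * (q.1 : ℝ)⁻¹ := by
    rw [← div_eq_mul_inv, Real.sqrt_div_self', one_div]
  simp only [Pi.sub_apply, Pi.zero_apply, sub_zero, h0, mul_zero, hscale, empMean]
  ring

end EmpMean

/-! ### Taylor expansion of the nonlinearity -/

theorem contDiff_one_deriv_of_contDiff_two {G : ℝ → ℝ} (hG : ContDiff ℝ 2 G) :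
    ContDiff ℝ 1 (deriv G) :=
  ContDiff.deriv' (n := 1) (by simpa only [one_add_one_eq_two] using hG)

theorem continuous_deriv_deriv_of_contDiff_two {G : ℝ → ℝ} (hG : ContDiff ℝ 2 G) :
    Continuous (deriv (deriv G)) :=
  (contDiff_one_deriv_of_contDiff_two hG).continuous_deriv_one

theorem abs_sub_sub_le_of_abs_deriv_sub_le {f : ℝ → ℝ} (hf : Differentiable ℝ f) {x y C : ℝ}
    (hC : ∀ ξ, |ξ - x| ≤ |y - x| → |deriv f ξ - deriv f x| ≤ C) :
    |f y - f x - deriv f x * (y - x)| ≤ C * |y - x| := by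
  have h := Convex.norm_image_sub_le_of_norm_hasDerivWithin_le
    (f := fun ξ => f ξ - deriv f x * ξ) (f' := fun ξ => deriv f ξ - deriv f x) (C := C)
    (s := Metric.closedBall x |y - x|) (x := x) (y := y)
    (fun ξ _ => (((hf ξ).hasDerivAt).sub
      (by simpa using (hasDerivAt_id ξ).const_mul (deriv f x))).hasDerivWithinAt)
    (fun ξ hξ => hC ξ (by simpa [Real.dist_eq] using hξ)) (convex_closedBall _ _)
    (by simp) (by simp [Real.dist_eq])
  rw [Real.norm_eq_abs, Real.norm_eq_abs] at h
  convert! h using 2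
  ring

section Taylor

variable {p : ℕ}

/-- A weight that dominates the affine functions of `v` with coefficients of modulus at most one;
it replaces `(1 + ‖v‖²)^(1/2)`, to which it is equivalent. -/
def weight (v : Fin p → ℝ) : ℝ := 1 + ∑ m, |v m|

theorem one_le_weight (v : Fin p → ℝ) : 1 ≤ weight v :=
  le_add_of_nonneg_right (Finset.sum_nonneg fun _ _ => abs_nonneg _)

theorem weight_pos (v : Fin p → ℝ) : 0 < weight v := one_pos.trans_le (one_le_weight v)

theorem abs_le_weight (v : Fin p → ℝ) (m : Fin p) : |v m| ≤ weight v :=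
  (Finset.single_le_sum (f := fun m => |v m|) (fun _ _ => abs_nonneg _)
    (Finset.mem_univ m)).trans (le_add_of_nonneg_left zero_le_one)

theorem continuous_weight : Continuous (weight : (Fin p → ℝ) → ℝ) := by
  unfold weight
  fun_prop

theorem weight_sq_le (v : Fin p → ℝ) : weight v ^ 2 ≤ 2 * (1 + (p : ℝ) ^ 2) * (1 + ‖v‖ ^ 2) := by
  have hsum : ∑ m, |v m| ≤ p * ‖v‖ := by
    simpa using Finset.sum_le_card_nsmul Finset.univ (fun m => |v m|) ‖v‖
      fun m _ => by simpa using norm_le_pi_norm v m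
  have hsq : (∑ m, |v m|) ^ 2 ≤ (p * ‖v‖) ^ 2 :=
    pow_le_pow_left₀ (Finset.sum_nonneg fun _ _ => abs_nonneg _) hsum 2
  unfold weight
  nlinarith [sq_nonneg (1 - ∑ m, |v m|), sq_nonneg (p : ℝ), sq_nonneg ‖v‖]

/-- The size of the perturbation that turns the `k`th coordinate `v k` into the affine function
`u ⬝ᵥ v + t` of `v`. -/
def formDist (k : Fin p) (u : Fin p → ℝ) (t : ℝ) : ℝ :=
  ∑ m, |u m - (1 : Matrix (Fin p) (Fin p) ℝ) k m| + |t|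

theorem formDist_nonneg (k : Fin p) (u : Fin p → ℝ) (t : ℝ) : 0 ≤ formDist k u t :=
  add_nonneg (Finset.sum_nonneg fun _ _ => abs_nonneg _) (abs_nonneg _)

theorem tendsto_formDist {ι : Type*} {L : Filter ι} {U : ι → Fin p → ℝ} {t : ι → ℝ} {k : Fin p}
    (hU : ∀ m, Tendsto (fun q => U q m - (1 : Matrix (Fin p) (Fin p) ℝ) k m) L (𝓝 0))
    (ht : Tendsto t L (𝓝 0)) : Tendsto (fun q => formDist k (U q) (t q)) L (𝓝 0) := by
  simpa [formDist] using (tendsto_finsetSum Finset.univ fun m _ => (hU m).abs).add ht.abs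

theorem dotProduct_eq_add_sum_sub_one (u v : Fin p → ℝ) (k : Fin p) :
    u ⬝ᵥ v = v k + ∑ m, (u m - (1 : Matrix (Fin p) (Fin p) ℝ) k m) * v m := by
  simp [dotProduct, sub_mul, Matrix.one_apply]

theorem abs_dotProduct_add_sub_le (u v : Fin p → ℝ) (t : ℝ) (k : Fin p) :
    |u ⬝ᵥ v + t - v k| ≤ formDist k u t * weight v :=
  calc |u ⬝ᵥ v + t - v k|
      = |∑ m, (u m - (1 : Matrix (Fin p) (Fin p) ℝ) k m) * v m + t| := by
        rw [dotProduct_eq_add_sum_sub_one u v k]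
        ring_nf
    _ ≤ ∑ m, |u m - (1 : Matrix (Fin p) (Fin p) ℝ) k m| * |v m| + |t| := by
      refine (abs_add_le _ _).trans (add_le_add_left ?_ _)
      simpa only [abs_mul] using Finset.abs_sum_le_sum_abs
        (fun m => (u m - (1 : Matrix (Fin p) (Fin p) ℝ) k m) * v m) Finset.univ
    _ ≤ ∑ m, |u m - (1 : Matrix (Fin p) (Fin p) ℝ) k m| * weight v + |t| * weight v := by
      gcongr with m
      · exact abs_le_weight v m
      · exact le_mul_of_one_le_right (abs_nonneg t) (one_le_weight v)
    _ = formDist k u t * weight v := by rw [formDist, add_mul, Finset.sum_mul]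

/-- The modulus of continuity of `f` at the `k`th coordinate of `v`, on the scale `η * weight v` and
multiplied by `weight v ^ 2`. -/
noncomputable def modulus (f : ℝ → ℝ) (k : Fin p) (η : ℝ) (v : Fin p → ℝ) : ℝ :=
  sSup ((fun θ => |f (v k + θ * (η * weight v)) - f (v k)|) '' Set.Icc (-1) 1) * weight v ^ 2

theorem continuous_modulus {f : ℝ → ℝ} (hf : Continuous f) (k : Fin p) (η : ℝ) :
    Continuous (modulus f k η) := by
  have hw := continuous_weight (p := p)
  refine Continuous.mul (isCompact_Icc.continuous_sSup
    (f := fun (v : Fin p → ℝ) (θ : ℝ) => |f (v k + θ * (η * weight v)) - f (v k)|) ?_) (hw.pow 2)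
  simp only [Function.HasUncurry.uncurry, id]
  fun_prop

theorem abs_sub_mul_le_modulus {f : ℝ → ℝ} (hf : Continuous f) (k : Fin p) {η : ℝ} (hη : 0 < η)
    (v : Fin p → ℝ) {y : ℝ} (hy : |y - v k| ≤ η * weight v) :
    |f y - f (v k)| * weight v ^ 2 ≤ modulus f k η v := by
  have hscale : 0 < η * weight v := mul_pos hη (weight_pos v)
  have hbdd : BddAbove ((fun θ => |f (v k + θ * (η * weight v)) - f (v k)|) '' Set.Icc (-1) 1) :=
    (isCompact_Icc.image (by fun_prop)).bddAbove
  unfold modulus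
  gcongr
  refine le_csSup hbdd ⟨(y - v k) / (η * weight v), ?_, ?_⟩
  · rw [Set.mem_Icc, ← abs_le, abs_div, abs_of_pos hscale]
    exact div_le_one_of_le₀ hy hscale.le
  · simp only [div_mul_cancel₀ _ hscale.ne', add_sub_cancel]

theorem modulus_nonneg (f : ℝ → ℝ) (k : Fin p) (η : ℝ) (v : Fin p → ℝ) : 0 ≤ modulus f k η v :=
  mul_nonneg (Real.sSup_nonneg (by rintro _ ⟨θ, _, rfl⟩; exact abs_nonneg _)) (sq_nonneg _)

theorem modulus_le {f : ℝ → ℝ} (k : Fin p) {η C : ℝ} (hη : 0 ≤ η) (v : Fin p → ℝ)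
    (h : ∀ y, |y - v k| ≤ η * weight v → |f y - f (v k)| * weight v ^ 2 ≤ C) :
    modulus f k η v ≤ C := by
  have hw : 0 < weight v ^ 2 := pow_pos (weight_pos v) 2
  have hscale : 0 ≤ η * weight v := mul_nonneg hη (weight_pos v).le
  unfold modulus
  rw [← le_div_iff₀ hw]
  refine csSup_le ((Set.nonempty_Icc.2 (by norm_num)).image _) ?_
  rintro _ ⟨θ, hθ, rfl⟩
  rw [le_div_iff₀ hw]
  refine h _ ?_
  rw [add_sub_cancel_left, abs_mul, abs_of_nonneg hscale]
  exact mul_le_of_le_one_left hscale (abs_le.2 hθ)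

theorem tendsto_modulus {f : ℝ → ℝ} (hf : Continuous f) (k : Fin p) (v : Fin p → ℝ) :
    Tendsto (fun η => modulus f k η v) (𝓝[>] 0) (𝓝 0) := by
  have hw : 0 < weight v ^ 2 := pow_pos (weight_pos v) 2
  rw [Metric.tendsto_nhds]
  intro ε hε
  obtain ⟨d, hd, hfd⟩ := Metric.continuousAt_iff.1 (hf.continuousAt (x := v k))
    (ε / 2 / weight v ^ 2) (by positivity)
  have hscale : Tendsto (fun η : ℝ => η * weight v) (𝓝[>] 0) (𝓝 0) := by
    simpa using (tendsto_id.mul_const (weight v)).mono_left (nhdsWithin_le_nhds (a := (0 : ℝ)))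
  filter_upwards [hscale.eventually_lt_const hd, self_mem_nhdsWithin] with η hηd hη
  rw [Real.dist_eq, sub_zero, abs_of_nonneg (modulus_nonneg _ _ _ _)]
  refine (modulus_le k (le_of_lt hη) v fun y hy => ?_).trans_lt (half_lt_self hε)
  have hclose := hfd (show dist y (v k) < d from (Real.dist_eq y _).trans_lt (hy.trans_lt hηd))
  rw [Real.dist_eq, lt_div_iff₀ hw] at hclose
  exact hclose.le

theorem abs_taylor_mul_weight_le_modulus {f : ℝ → ℝ} (hf : ContDiff ℝ 1 f) (k : Fin p)
    {η d : ℝ} (hη : 0 < η) (hdη : d ≤ η) {v : Fin p → ℝ} {y : ℝ} (hy : |y - v k| ≤ d * weight v) :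
    |f y - f (v k) - deriv f (v k) * (y - v k)| * weight v ≤ d * modulus (deriv f) k η v := by
  have hw := weight_pos v
  have htaylor := abs_sub_sub_le_of_abs_deriv_sub_le (hf.differentiable one_ne_zero)
    (C := modulus (deriv f) k η v / weight v ^ 2) (x := v k) (y := y) fun ξ hξ => by
      rw [le_div_iff₀ (by positivity)]
      exact abs_sub_mul_le_modulus hf.continuous_deriv_one k hη v
        (hξ.trans (hy.trans (by gcongr)))
  calc |f y - f (v k) - deriv f (v k) * (y - v k)| * weight v
      ≤ modulus (deriv f) k η v / weight v ^ 2 * |y - v k| * weight v := by gcongr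
    _ ≤ modulus (deriv f) k η v / weight v ^ 2 * (d * weight v) * weight v := by
      have := modulus_nonneg (deriv f) k η v
      gcongr
    _ = d * modulus (deriv f) k η v := by field_simp

/-- The factor by which `|G y - G (v k)|` is bounded when `y` is close to `v k` on the scale of
`weight v`. -/
noncomputable def contrastEnvelope (G : ℝ → ℝ) (k : Fin p) (η : ℝ) (v : Fin p → ℝ) : ℝ :=
  |deriv G (v k)| * weight v + |deriv (deriv G) (v k)| * weight v ^ 2
    + modulus (deriv (deriv G)) k η v

theorem abs_sub_le_contrastEnvelope {G : ℝ → ℝ} (hG : ContDiff ℝ 2 G) (k : Fin p) {η d : ℝ}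
    (hη : 0 < η) (hdη : d ≤ η) (hd1 : d ≤ 1) {v : Fin p → ℝ} {y : ℝ}
    (hy : |y - v k| ≤ d * weight v) : |G y - G (v k)| ≤ d * contrastEnvelope G k η v := by
  have hw := weight_pos v
  have hm := modulus_nonneg (deriv (deriv G)) k η v
  have hderiv : ∀ ξ ∈ Metric.closedBall (v k) (d * weight v),
      ‖deriv G ξ‖ ≤ contrastEnvelope G k η v / weight v := fun ξ hξ => by
    rw [Metric.mem_closedBall, Real.dist_eq] at hξ
    have htaylor := abs_taylor_mul_weight_le_modulus (contDiff_one_deriv_of_contDiff_two hG) k hη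
      hdη hξ
    rw [le_div_iff₀ hw, Real.norm_eq_abs]
    calc |deriv G ξ| * weight v
        = |deriv G (v k) + deriv (deriv G) (v k) * (ξ - v k)
            + (deriv G ξ - deriv G (v k) - deriv (deriv G) (v k) * (ξ - v k))| * weight v := by
          ring_nf
      _ ≤ (|deriv G (v k)| + |deriv (deriv G) (v k)| * |ξ - v k|
            + |deriv G ξ - deriv G (v k) - deriv (deriv G) (v k) * (ξ - v k)|) * weight v := by
          rw [← abs_mul]
          gcongr
          exact abs_add_three _ _ _
      _ ≤ (|deriv G (v k)| + |deriv (deriv G) (v k)| * (1 * weight v)) * weight v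
            + 1 * modulus (deriv (deriv G)) k η v := by
          rw [add_mul]
          refine add_le_add ?_ (htaylor.trans (by gcongr))
          gcongr
          exact hξ.trans (by gcongr)
      _ = contrastEnvelope G k η v := by rw [contrastEnvelope]; ring
  have hmvt := Convex.norm_image_sub_le_of_norm_deriv_le
    (fun ξ _ => hG.differentiable (by norm_num) ξ) hderiv (convex_closedBall _ _)
    (Metric.mem_closedBall_self ((abs_nonneg _).trans hy))
    (Metric.mem_closedBall.2 ((Real.dist_eq _ _).trans_le hy))
  calc |G y - G (v k)| ≤ contrastEnvelope G k η v / weight v * |y - v k| := hmvt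
    _ ≤ contrastEnvelope G k η v / weight v * (d * weight v) := by
      gcongr
      unfold contrastEnvelope
      positivity
    _ = d * contrastEnvelope G k η v := by field_simp

theorem exists_dotProduct_add_eq {r : ℝ} (hr : 0 ≤ r) (k : Fin p) {v : Fin p → ℝ} {y : ℝ}
    (hy : |y - v k| ≤ r * weight v) :
    ∃ (u : Fin p → ℝ) (t : ℝ), ‖u - Pi.single k 1‖ ≤ r ∧ |t| ≤ r ∧ u ⬝ᵥ v + t = y := by
  have hw := weight_pos v
  let θ : ℝ := (y - v k) / weight v
  have hθ : |θ| ≤ r := by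
    rw [abs_div, abs_of_pos hw]
    exact div_le_of_le_mul₀ hw.le hr hy
  let s : Fin p → ℝ := fun m => θ * SignType.sign (v m)
  have hs : s ⬝ᵥ v = θ * ∑ m, |v m| := by
    simp only [s, dotProduct, Finset.mul_sum, mul_assoc, sign_mul_self]
  refine ⟨Pi.single k 1 + s, θ, ?_, hθ, ?_⟩
  · rw [add_sub_cancel_left, pi_norm_le_iff_of_nonneg hr]
    intro m
    rcases h : SignType.sign (v m) <;> simp [s, h, hr, hθ]
  · calc (Pi.single k 1 + s) ⬝ᵥ v + θ = v k + θ * weight v := by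
          rw [add_dotProduct, single_one_dotProduct, hs, weight]
          ring
      _ = y := by rw [div_mul_cancel₀ _ hw.ne', add_sub_cancel]

variable {Ω : Type*} [MeasurableSpace Ω] {P : Measure Ω} {G : ℝ → ℝ} {Z : Ω → Fin p → ℝ}

theorem LocallyDominated.exists_integrable_bound (h : LocallyDominated P G Z) (k : Fin p) :
    ∃ r > 0, ∃ M : Ω → ℝ, Integrable M P ∧ ∀ᵐ ω ∂P, ∀ y, |y - Z ω k| ≤ r * weight (Z ω) →
      |deriv (deriv G) y| * weight (Z ω) ^ 2 ≤ M ω := by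
  obtain ⟨r, hr, M, hM, hae⟩ := h k
  refine ⟨r, hr, fun ω => 2 * (1 + (p : ℝ) ^ 2) * M ω, hM.const_mul _, ?_⟩
  filter_upwards [hae] with ω hω y hy
  obtain ⟨u, t, hu, ht, rfl⟩ := exists_dotProduct_add_eq hr.le k hy
  calc |deriv (deriv G) (u ⬝ᵥ Z ω + t)| * weight (Z ω) ^ 2
      ≤ |deriv (deriv G) (u ⬝ᵥ Z ω + t)| * (2 * (1 + (p : ℝ) ^ 2) * (1 + ‖Z ω‖ ^ 2)) := by
        gcongr
        exact weight_sq_le _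
    _ = 2 * (1 + (p : ℝ) ^ 2) * (|deriv (deriv G) (u ⬝ᵥ Z ω + t)| * (1 + ‖Z ω‖ ^ 2)) := by ring
    _ ≤ 2 * (1 + (p : ℝ) ^ 2) * M ω := by gcongr; exact hω u t hu ht

theorem LocallyDominated.integrable_deriv_mul (h : LocallyDominated P G Z) (hZ : Measurable Z)
    (k : Fin p) {φ : (Fin p → ℝ) → ℝ} (hφ : Measurable φ) (hφw : ∀ v, |φ v| ≤ weight v ^ 2) :
    Integrable (fun ω => deriv (deriv G) (Z ω k) * φ (Z ω)) P := by
  obtain ⟨r, hr, M, hM, hae⟩ := h.exists_integrable_bound k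
  have hmeas : Measurable fun ω => deriv (deriv G) (Z ω k) * φ (Z ω) :=
    ((measurable_deriv _).comp ((measurable_pi_apply k).comp hZ)).mul (hφ.comp hZ)
  refine hM.mono' hmeas.aestronglyMeasurable ?_
  filter_upwards [hae] with ω hω
  rw [Real.norm_eq_abs, abs_mul]
  exact (mul_le_mul_of_nonneg_left (hφw _) (abs_nonneg _)).trans
    (hω _ (by simpa using mul_nonneg hr.le (weight_pos _).le))

theorem LocallyDominated.exists_integrable_modulus_le (h : LocallyDominated P G Z) (k : Fin p) :
    ∃ r > 0, ∃ M : Ω → ℝ, Integrable M P ∧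
      ∀ η ∈ Set.Ioc 0 r, ∀ᵐ ω ∂P, ‖modulus (deriv (deriv G)) k η (Z ω)‖ ≤ M ω := by
  obtain ⟨r, hr, M, hM, hae⟩ := h.exists_integrable_bound k
  refine ⟨r, hr, fun ω => 2 * M ω, hM.const_mul 2, fun η hη => ?_⟩
  filter_upwards [hae] with ω hω
  have hw := weight_pos (Z ω)
  rw [Real.norm_eq_abs, abs_of_nonneg (modulus_nonneg _ _ _ _)]
  refine modulus_le k hη.1.le _ fun y hy => ?_
  calc |deriv (deriv G) y - deriv (deriv G) (Z ω k)| * weight (Z ω) ^ 2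
      ≤ (|deriv (deriv G) y| + |deriv (deriv G) (Z ω k)|) * weight (Z ω) ^ 2 := by
        gcongr
        exact abs_sub _ _
    _ = |deriv (deriv G) y| * weight (Z ω) ^ 2
        + |deriv (deriv G) (Z ω k)| * weight (Z ω) ^ 2 := add_mul _ _ _
    _ ≤ M ω + M ω := add_le_add (hω y (hy.trans (by gcongr; exact hη.2)))
        (hω _ (by simpa using mul_nonneg hr.le hw.le))
    _ = 2 * M ω := (two_mul _).symm

theorem LocallyDominated.exists_modulus_integral_lt (h : LocallyDominated P G Z)
    (hG : Continuous (deriv (deriv G))) (hZ : Measurable Z) (k : Fin p) {ε : ℝ} (hε : 0 < ε) :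
    ∃ η > 0, Integrable (fun ω => modulus (deriv (deriv G)) k η (Z ω)) P ∧
      ∫ ω, modulus (deriv (deriv G)) k η (Z ω) ∂P < ε := by
  obtain ⟨r, hr, M, hM, hbound⟩ := h.exists_integrable_modulus_le k
  have hmeas : ∀ η, AEStronglyMeasurable (fun ω => modulus (deriv (deriv G)) k η (Z ω)) P :=
    fun η => ((continuous_modulus hG k η).measurable.comp hZ).aestronglyMeasurable
  have hsmall : ∀ᶠ η : ℝ in 𝓝[>] 0, η ∈ Set.Ioc 0 r := Ioc_mem_nhdsGT hr
  have hlim : Tendsto (fun η => ∫ ω, modulus (deriv (deriv G)) k η (Z ω) ∂P) (𝓝[>] 0)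
      (𝓝 (∫ _, (0 : ℝ) ∂P)) :=
    tendsto_integral_filter_of_dominated_convergence M (Eventually.of_forall hmeas)
      (hsmall.mono hbound) hM (Eventually.of_forall fun ω => tendsto_modulus hG k (Z ω))
  rw [integral_zero] at hlim
  obtain ⟨η, hηε, hη⟩ := ((hlim.eventually_lt_const hε).and hsmall).exists
  exact ⟨η, hη.1, hM.mono' (hmeas η) (hbound η hη), hηε⟩

end Taylor

/-! ### Expansion of the empirical means around the true directions -/

section Expansion

variable {Ω : Type*} {p : ℕ} {z : ℕ → Ω → Fin p → ℝ}

theorem empMean_taylor_remainder (f f' : ℝ → ℝ) (φ : (Fin p → ℝ) → ℝ) (k : Fin p) (u : Fin p → ℝ)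
    (t : ℝ) (q : ℕ × Ω) :
    empMean z (fun v => (f (u ⬝ᵥ v + t) - f (v k) - f' (v k) * (u ⬝ᵥ v + t - v k)) * φ v) q
      = empMean z (fun v => f (u ⬝ᵥ v + t) * φ v) q - empMean z (fun v => f (v k) * φ v) q
        - (∑ m, (u m - (1 : Matrix (Fin p) (Fin p) ℝ) k m)
              * empMean z (fun v => f' (v k) * (v m * φ v)) q
            + t * empMean z (fun v => f' (v k) * φ v) q) := by
  simp only [← empMean_const_mul, ← empMean_sum, ← empMean_sub, ← empMean_add]
  congr 1
  ext v
  have hsum : ∑ m, (u m - (1 : Matrix (Fin p) (Fin p) ℝ) k m) * (f' (v k) * (v m * φ v))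
      = f' (v k) * φ v * ∑ m, (u m - (1 : Matrix (Fin p) (Fin p) ℝ) k m) * v m := by
    rw [Finset.mul_sum]
    exact Finset.sum_congr rfl fun m _ => by ring
  rw [hsum, dotProduct_eq_add_sum_sub_one u v k]
  ring

variable [MeasurableSpace Ω] {P : Measure Ω} {G : ℝ → ℝ} {k : Fin p}

theorem measurable_contrastEnvelope (hG : ContDiff ℝ 2 G) (k : Fin p) (η : ℝ) :
    Measurable (contrastEnvelope G k η) := by
  have hderiv := hG.continuous_deriv one_le_two
  have hderiv2 := continuous_deriv_deriv_of_contDiff_two hG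
  have hmod := continuous_modulus hderiv2 k η
  have hw := continuous_weight (p := p)
  unfold contrastEnvelope
  exact Continuous.measurable (by fun_prop)

theorem exists_integrable_contrastEnvelope (hG : ContDiff ℝ 2 G) {Z : Ω → Fin p → ℝ}
    (hZ : Measurable Z) (hdom : LocallyDominated P G Z)
    (hint : Integrable (fun ω => deriv G (Z ω k) * weight (Z ω)) P) :
    ∃ η > 0, Integrable (fun ω => contrastEnvelope G k η (Z ω)) P := by
  obtain ⟨η, hη, hmod, -⟩ := hdom.exists_modulus_integral_lt
    (continuous_deriv_deriv_of_contDiff_two hG) hZ k one_pos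
  have hderiv2 : Integrable (fun ω => deriv (deriv G) (Z ω k) * weight (Z ω) ^ 2) P :=
    hdom.integrable_deriv_mul hZ k (φ := fun v => weight v ^ 2)
      (continuous_weight.pow 2).measurable fun v => (abs_of_nonneg (sq_nonneg _)).le
  refine ⟨η, hη, ((hint.abs.add hderiv2.abs).add hmod).congr (Eventually.of_forall fun ω => ?_)⟩
  simp [contrastEnvelope, abs_mul, abs_of_pos (weight_pos (Z ω))]

variable [IsProbabilityMeasure P] {U : ℕ × Ω → Fin p → ℝ} {t : ℕ × Ω → ℝ}

theorem isLittleO_empMean_taylor (hG : ContDiff ℝ 2 G) (hz : IsIIDSample P z)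
    (hdom : LocallyDominated P G (z 0))
    (hU : ∀ m, Tendsto (fun q => U q m - (1 : Matrix (Fin p) (Fin p) ℝ) k m) (probFilter P) (𝓝 0))
    (ht : Tendsto t (probFilter P) (𝓝 0)) {φ : (Fin p → ℝ) → ℝ} (hφw : ∀ v, |φ v| ≤ weight v) :
    (fun q => empMean z (fun v => deriv G (U q ⬝ᵥ v + t q) * φ v) q
        - empMean z (fun v => deriv G (v k) * φ v) q
        - (∑ m, (U q m - (1 : Matrix (Fin p) (Fin p) ℝ) k m)
              * empMean z (fun v => deriv (deriv G) (v k) * (v m * φ v)) q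
            + t q * empMean z (fun v => deriv (deriv G) (v k) * φ v) q))
      =o[probFilter P] fun q => formDist k (U q) (t q) := by
  refine isLittleO_iff.2 fun c hc => ?_
  have hcont := continuous_deriv_deriv_of_contDiff_two hG
  obtain ⟨η, hη, hmod, hmodc⟩ := hdom.exists_modulus_integral_lt hcont (hz.measurable 0) k hc
  have hlln := hz.tendsto_empMean (continuous_modulus hcont k η).measurable ⟨hmod, rfl⟩
  filter_upwards [hlln.eventually_lt_const hmodc, (tendsto_formDist hU ht).eventually_lt_const hη]
    with q hqc hqη
  have hd0 := formDist_nonneg k (U q) (t q)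
  rw [← empMean_taylor_remainder, Real.norm_eq_abs, Real.norm_eq_abs, abs_of_nonneg hd0]
  calc |empMean z (fun v => (deriv G (U q ⬝ᵥ v + t q) - deriv G (v k)
          - deriv (deriv G) (v k) * (U q ⬝ᵥ v + t q - v k)) * φ v) q|
      ≤ empMean z (fun v => formDist k (U q) (t q) * modulus (deriv (deriv G)) k η v) q := by
        refine abs_empMean_le fun i _ => ?_
        rw [abs_mul]
        exact (mul_le_mul_of_nonneg_left (hφw _) (abs_nonneg _)).trans
          (abs_taylor_mul_weight_le_modulus (contDiff_one_deriv_of_contDiff_two hG) k hη hqη.le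
            (abs_dotProduct_add_sub_le _ _ _ _))
    _ = formDist k (U q) (t q) * empMean z (modulus (deriv (deriv G)) k η) q :=
      empMean_const_mul _ _ _
    _ ≤ c * formDist k (U q) (t q) := by rw [mul_comm]; gcongr

theorem tendsto_empMean_contrast (hG : ContDiff ℝ 2 G) (hz : IsIIDSample P z)
    (hdom : LocallyDominated P G (z 0)) (hG0 : Integrable (fun ω => G (z 0 ω k)) P)
    (hint : Integrable (fun ω => deriv G (z 0 ω k) * weight (z 0 ω)) P)
    (hU : ∀ m, Tendsto (fun q => U q m - (1 : Matrix (Fin p) (Fin p) ℝ) k m) (probFilter P) (𝓝 0))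
    (ht : Tendsto t (probFilter P) (𝓝 0)) :
    Tendsto (fun q => empMean z (fun v => G (U q ⬝ᵥ v + t q)) q) (probFilter P)
      (𝓝 (nu P G fun ω => z 0 ω k)) := by
  obtain ⟨η, hη, henv⟩ := exists_integrable_contrastEnvelope hG (hz.measurable 0) hdom hint
  have hd := tendsto_formDist hU ht
  have hbound := hd.mul (hz.tendsto_empMean (measurable_contrastEnvelope hG k η) ⟨henv, rfl⟩)
  rw [zero_mul] at hbound
  have hdiff : Tendsto (fun q => empMean z (fun v => G (U q ⬝ᵥ v + t q)) q
      - empMean z (fun v => G (v k)) q) (probFilter P) (𝓝 0) := by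
    refine squeeze_zero_norm' ?_ hbound
    filter_upwards [hd.eventually_lt_const hη, hd.eventually_lt_const one_pos] with q hqη hq1
    rw [Real.norm_eq_abs, ← empMean_sub, ← empMean_const_mul]
    exact abs_empMean_le fun i _ => abs_sub_le_contrastEnvelope hG k hη hqη.le hq1.le
      (abs_dotProduct_add_sub_le _ _ _ _)
  have hlln := hz.tendsto_empMean (hG.continuous.measurable.comp (measurable_pi_apply k))
    ⟨hG0, rfl⟩
  simpa [Function.comp_def, nu] using hdiff.add hlln

end Expansion

/-! ### The statistics as empirical means -/

section Statistics

variable {Ω : Type*} {p : ℕ} {z x : ℕ → Ω → Fin p → ℝ} {loc : Fin p → ℝ} {G : ℝ → ℝ}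

/-- The empirical mean of the latent vectors. -/
noncomputable def latentMean (z : ℕ → Ω → Fin p → ℝ) (q : ℕ × Ω) : Fin p → ℝ :=
  fun k => empMean z (fun v => v k) q

theorem sub_sampleMean (hx : ∀ i ω, x i ω = loc + z i ω) {q : ℕ × Ω} (hq : 0 < (q.1 : ℝ)) (i : ℕ) :
    x i q.2 - sampleMean q.1 (fun i => x i q.2) = z i q.2 - latentMean z q := by
  ext k
  simp only [sampleMean, hx, latentMean, empMean, Finset.sum_add_distrib, Finset.sum_const,
    Finset.card_range, Pi.sub_apply, Pi.add_apply, Pi.smul_apply, Finset.sum_apply, smul_eq_mul,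
    nsmul_eq_mul, Pi.natCast_apply, Pi.mul_apply]
  field_simp
  ring

theorem empMean_sub_mul_sub_latentMean {q : ℕ × Ω} (hq : 0 < (q.1 : ℝ)) (k m : Fin p) :
    empMean z (fun v => (v k - latentMean z q k) * (v m - latentMean z q m)) q
      = empMean z (fun v => v k * v m) q - latentMean z q k * latentMean z q m := by
  have hexpand : (fun v : Fin p → ℝ => (v k - latentMean z q k) * (v m - latentMean z q m))
      = fun v => v k * v m - latentMean z q m * v k - latentMean z q k * v m
        + latentMean z q k * latentMean z q m := by
    ext v
    ring
  rw [hexpand, empMean_add, empMean_sub, empMean_sub, empMean_const_mul, empMean_const_mul,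
    empMean_const hq]
  simp only [latentMean]
  ring

theorem sampleCov_apply (hx : ∀ i ω, x i ω = loc + z i ω) {q : ℕ × Ω} (hq : 0 < (q.1 : ℝ))
    (k m : Fin p) :
    sampleCov q.1 (fun i => x i q.2) k m
      = empMean z (fun v => v k * v m) q - latentMean z q k * latentMean z q m := by
  rw [← empMean_sub_mul_sub_latentMean hq]
  simp only [sampleCov, sub_sampleMean hx hq, empMean, Matrix.smul_apply, Matrix.sum_apply,
    Matrix.vecMulVec_apply, Pi.sub_apply, smul_eq_mul]

/-- The offset that centring the data adds to the linear form `γ`, which turns the statistics into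
empirical means over the latent vectors. -/
noncomputable def shift (z : ℕ → Ω → Fin p → ℝ) (γ : Fin p → ℝ) (q : ℕ × Ω) : ℝ :=
  -(γ ⬝ᵥ latentMean z q)

theorem dotProduct_sub_latentMean (γ v : Fin p → ℝ) (q : ℕ × Ω) :
    γ ⬝ᵥ (v - latentMean z q) = γ ⬝ᵥ v + shift z γ q := by
  rw [dotProduct_sub, sub_eq_add_neg, shift]

theorem sampleG_eq (hx : ∀ i ω, x i ω = loc + z i ω) {q : ℕ × Ω} (hq : 0 < (q.1 : ℝ))
    (γ : Fin p → ℝ) :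
    sampleG G q.1 (fun i => x i q.2) γ
      = empMean z (fun v => G (γ ⬝ᵥ v + shift z γ q)) q := by
  simp only [sampleG, sub_sampleMean hx hq, dotProduct_sub_latentMean, empMean]

theorem sampleT_apply (hx : ∀ i ω, x i ω = loc + z i ω) {q : ℕ × Ω} (hq : 0 < (q.1 : ℝ))
    (γ : Fin p → ℝ) (m : Fin p) :
    sampleT G q.1 (fun i => x i q.2) γ m
      = empMean z (fun v => deriv G (γ ⬝ᵥ v + shift z γ q) * v m) q
        - latentMean z q m
          * empMean z (fun v => deriv G (γ ⬝ᵥ v + shift z γ q) * 1) q := by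
  rw [← empMean_const_mul, ← empMean_sub]
  simp only [sampleT, sub_sampleMean hx hq, dotProduct_sub_latentMean, empMean, Pi.smul_apply,
    Finset.sum_apply, Pi.sub_apply, smul_eq_mul]
  congr 1
  exact Finset.sum_congr rfl fun i _ => by ring

end Statistics

/-! ### Moments of influence functions -/

section Moments

variable {Ω : Type*} [MeasurableSpace Ω] {P : Measure Ω}

theorem memLp_two_mul_of_indepFun {X Y : Ω → ℝ} (hX : MemLp X 2 P) (hY : MemLp Y 2 P)
    (h : IndepFun X Y P) : MemLp (fun ω => X ω * Y ω) 2 P := by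
  refine (memLp_two_iff_integrable_sq
    (hX.aestronglyMeasurable.mul hY.aestronglyMeasurable)).2 ?_
  have hsq : IndepFun (fun ω => X ω ^ 2) (fun ω => Y ω ^ 2) P :=
    h.comp (measurable_id.pow_const 2) (measurable_id.pow_const 2)
  exact (hsq.integrable_mul hX.integrable_sq hY.integrable_sq).congr
    (Eventually.of_forall fun _ => (mul_pow _ _ 2).symm)

variable {p : ℕ} {Z : Ω → Fin p → ℝ} {G : ℝ → ℝ} {j k l m : Fin p}

/-- Independent components with mean zero and variance one, any number of which may be Gaussian. -/
structure IsStandardizedSource (P : Measure Ω) (Z : Ω → Fin p → ℝ) : Prop where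
  indep : iIndepFun (fun (k : Fin p) (ω : Ω) => Z ω k) P
  mean_zero : ∀ k, ∫ ω, Z ω k ∂P = 0
  second_moment : ∀ k, ∫ ω, Z ω k ^ 2 ∂P = 1

theorem IsSource.isStandardizedSource (hs : IsSource P Z) : IsStandardizedSource P Z :=
  ⟨hs.indep, hs.mean_zero, hs.second_moment⟩

theorem IsStandardizedSource.indepFun_comp (hs : IsStandardizedSource P Z) (hjl : j ≠ l)
    {f h : ℝ → ℝ} (hf : Measurable f) (hh : Measurable h) :
    IndepFun (fun ω => f (Z ω j)) (fun ω => h (Z ω l)) P :=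
  (hs.indep.indepFun hjl).comp hf hh

theorem IsStandardizedSource.indepFun_mul_comp (hs : IsStandardizedSource P Z) (hZ : Measurable Z)
    (hjl : j ≠ l) (hml : m ≠ l) {f : ℝ → ℝ} (hf : Measurable f) :
    IndepFun (fun ω => f (Z ω j) * Z ω m) (fun ω => Z ω l) P :=
  (hs.indep.indepFun_prodMk (fun k => (measurable_pi_apply k).comp hZ) j m l hjl hml).comp
    (φ := fun y : ℝ × ℝ => f y.1 * y.2) ((hf.comp measurable_fst).mul measurable_snd) measurable_id

theorem IsStandardizedSource.hasMean_sq (hs : IsStandardizedSource P Z) (k : Fin p) :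
    HasMean P (fun ω => Z ω k ^ 2) 1 := by
  refine ⟨?_, hs.second_moment k⟩
  by_contra h
  exact zero_ne_one ((integral_undef h).symm.trans (hs.second_moment k))

theorem IsStandardizedSource.memLp (hs : IsStandardizedSource P Z) (hZ : Measurable Z)
    (k : Fin p) : MemLp (fun ω => Z ω k) 2 P :=
  (memLp_two_iff_integrable_sq ((measurable_pi_apply k).comp hZ).aestronglyMeasurable).2
    (hs.hasMean_sq k).1

theorem HasMoments.memLp_mul (hmom : HasMoments P G Z) (hs : IsStandardizedSource P Z)
    (hZ : Measurable Z) (k m : Fin p) : MemLp (fun ω => Z ω k * Z ω m) 2 P := by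
  by_cases h : k = m
  · subst h
    have hm : Measurable fun ω => Z ω k := (measurable_pi_apply k).comp hZ
    refine (memLp_two_iff_integrable_sq (hm.mul hm).aestronglyMeasurable).2 ?_
    exact (hmom.fourth k).congr (Eventually.of_forall fun ω => by simp only [Pi.mul_apply]; ring)
  · exact memLp_two_mul_of_indepFun (hs.memLp hZ k) (hs.memLp hZ m) (hs.indep.indepFun h)

/-- The part of `g = deriv G` that is orthogonal to the affine functions under the law of the
component `k`. -/
noncomputable def residual (P : Measure Ω) (G : ℝ → ℝ) (Z : Ω → Fin p → ℝ) (k : Fin p) (y : ℝ) :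
    ℝ :=
  deriv G y - (∫ ω, deriv G (Z ω k) ∂P) - lam P G (fun ω => Z ω k) * y

/-- The common form of the influence functions of the `(j, l)` entries of the three estimates. -/
noncomputable def influence (P : Measure Ω) (G : ℝ → ℝ) (Z : Ω → Fin p → ℝ) (j l : Fin p)
    (a b c : ℝ) (v : Fin p → ℝ) : ℝ :=
  a * (residual P G Z j (v j) * v l) + b * (residual P G Z l (v l) * v j) + c * (v j * v l)

theorem measurable_residual (k : Fin p) : Measurable (residual P G Z k) :=
  ((measurable_deriv G).sub_const _).sub (measurable_id.const_mul _)

theorem measurable_influence (a b c : ℝ) : Measurable (influence P G Z j l a b c) := by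
  have hj := measurable_residual (P := P) (G := G) (Z := Z) j
  have hl := measurable_residual (P := P) (G := G) (Z := Z) l
  unfold influence
  fun_prop

variable [IsProbabilityMeasure P]

theorem IsStandardizedSource.hasMean (hs : IsStandardizedSource P Z) (hZ : Measurable Z)
    (k : Fin p) : HasMean P (fun ω => Z ω k) 0 :=
  ⟨(hs.memLp hZ k).integrable one_le_two, hs.mean_zero k⟩

theorem IsStandardizedSource.hasMean_comp_mul (hs : IsStandardizedSource P Z) (hZ : Measurable Z)
    (hjl : j ≠ l) {f : ℝ → ℝ} (hf : Measurable f) (hfi : Integrable (fun ω => f (Z ω j)) P) :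
    HasMean P (fun ω => f (Z ω j) * Z ω l) 0 := by
  simpa using HasMean.mul_of_indepFun ⟨hfi, rfl⟩ (hs.hasMean hZ l)
    (hs.indepFun_comp hjl hf measurable_id)

theorem IsStandardizedSource.hasMean_mul (hs : IsStandardizedSource P Z) (hZ : Measurable Z)
    (k m : Fin p) :
    HasMean P (fun ω => Z ω k * Z ω m) ((1 : Matrix (Fin p) (Fin p) ℝ) k m) := by
  by_cases h : k = m
  · subst h
    simpa [sq] using hs.hasMean_sq k
  · simpa [h] using hs.hasMean_comp_mul hZ h measurable_id (hs.hasMean hZ k).1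

theorem HasMoments.hasMean_nonlin_mul (hmom : HasMoments P G Z) (hs : IsStandardizedSource P Z)
    (hZ : Measurable Z) (k m : Fin p) :
    HasMean P (fun ω => deriv G (Z ω k) * Z ω m)
      (lam P G (fun ω => Z ω k) * (1 : Matrix (Fin p) (Fin p) ℝ) k m) := by
  by_cases h : k = m
  · subst h
    rw [Matrix.one_apply_eq, mul_one]
    exact ⟨hmom.nonlin_mul k, rfl⟩
  · simpa [h] using hs.hasMean_comp_mul hZ h (measurable_deriv G)
      ((hmom.nonlin k).integrable one_le_two)

theorem HasMoments.hasMean_deriv_nonlin_mul (hmom : HasMoments P G Z)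
    (hs : IsStandardizedSource P Z) (hZ : Measurable Z) (hjl : j ≠ l) :
    HasMean P (fun ω => deriv (deriv G) (Z ω j) * Z ω l) 0 :=
  hs.hasMean_comp_mul hZ hjl (measurable_deriv _) (hmom.deriv_nonlin j)

theorem HasMoments.hasMean_deriv_nonlin_mul_mul (hmom : HasMoments P G Z)
    (hs : IsStandardizedSource P Z) (hZ : Measurable Z) (hjl : j ≠ l) (m : Fin p) :
    HasMean P (fun ω => deriv (deriv G) (Z ω j) * (Z ω m * Z ω l))
      (del P G (fun ω => Z ω j) * (1 : Matrix (Fin p) (Fin p) ℝ) m l) := by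
  have hg := measurable_deriv (deriv G)
  by_cases hml : m = l
  · subst hml
    simpa [sq, del] using HasMean.mul_of_indepFun ⟨hmom.deriv_nonlin j, rfl⟩ (hs.hasMean_sq m)
      (hs.indepFun_comp hjl hg (measurable_id.pow_const 2))
  · have hint : Integrable (fun ω => deriv (deriv G) (Z ω j) * Z ω m) P := by
      by_cases hjm : j = m
      · exact hjm ▸ hmom.deriv_nonlin_mul j
      · exact (hmom.hasMean_deriv_nonlin_mul hs hZ hjm).1
    simpa [hml, mul_assoc] using HasMean.mul_of_indepFun ⟨hint, rfl⟩ (hs.hasMean hZ l)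
      (hs.indepFun_mul_comp hZ hjl hml hg)

theorem HasMoments.memLp_residual (hmom : HasMoments P G Z) (hs : IsStandardizedSource P Z)
    (hZ : Measurable Z) (k : Fin p) : MemLp (fun ω => residual P G Z k (Z ω k)) 2 P :=
  ((hmom.nonlin k).sub (memLp_const _)).sub ((hs.memLp hZ k).const_mul _)

theorem HasMoments.hasMean_residual_mul_self (hmom : HasMoments P G Z)
    (hs : IsStandardizedSource P Z) (hZ : Measurable Z) (k : Fin p) :
    HasMean P (fun ω => residual P G Z k (Z ω k) * Z ω k) 0 := by
  have hgZ := hmom.hasMean_nonlin_mul hs hZ k k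
  have hcZ := (hs.hasMean hZ k).const_mul (∫ ω, deriv G (Z ω k) ∂P)
  have hZ2 := (hs.hasMean_sq k).const_mul (lam P G fun ω => Z ω k)
  exact ((hgZ.sub hcZ).sub hZ2).congr (fun ω => by simp only [residual]; ring) (by simp)

theorem HasMoments.hasMean_residual_sq (hmom : HasMoments P G Z) (hs : IsStandardizedSource P Z)
    (hZ : Measurable Z) (k : Fin p) :
    HasMean P (fun ω => residual P G Z k (Z ω k) ^ 2)
      (sigmaSq P G (fun ω => Z ω k) - lam P G (fun ω => Z ω k) ^ 2) := by
  set c := ∫ ω, deriv G (Z ω k) ∂P with hc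
  set a := lam P G (fun ω => Z ω k) with ha
  have hg2 : HasMean P (fun ω => (deriv G (Z ω k) - c) ^ 2) (sigmaSq P G fun ω => Z ω k) :=
    ⟨((hmom.nonlin k).sub (memLp_const c)).integrable_sq,
      (variance_eq_integral (hmom.nonlin k).aestronglyMeasurable.aemeasurable).symm⟩
  have hgZ := (hmom.hasMean_nonlin_mul hs hZ k k).const_mul (2 * a)
  have hcZ := (hs.hasMean hZ k).const_mul (2 * a * c)
  have hZ2 := (hs.hasMean_sq k).const_mul (a ^ 2)
  refine (((hg2.sub hgZ).add hcZ).add hZ2).congr (fun ω => ?_) ?_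
  · simp only [residual, ← hc, ← ha]
    ring
  · rw [Matrix.one_apply_eq, ← ha]
    ring

theorem HasMoments.memLp_influence (hmom : HasMoments P G Z) (hs : IsStandardizedSource P Z)
    (hZ : Measurable Z) (hjl : j ≠ l) (a b c : ℝ) :
    MemLp (fun ω => influence P G Z j l a b c (Z ω)) 2 P := by
  have hres : ∀ {k m : Fin p}, k ≠ m → MemLp (fun ω => residual P G Z k (Z ω k) * Z ω m) 2 P :=
    fun {k m} hkm => memLp_two_mul_of_indepFun (hmom.memLp_residual hs hZ k) (hs.memLp hZ m)
      (hs.indepFun_comp hkm (measurable_residual k) measurable_id)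
  exact (((hres hjl).const_mul a).add ((hres hjl.symm).const_mul b)).add
    ((hmom.memLp_mul hs hZ j l).const_mul c)

theorem HasMoments.hasMean_influence (hmom : HasMoments P G Z) (hs : IsStandardizedSource P Z)
    (hZ : Measurable Z) (hjl : j ≠ l) (a b c : ℝ) :
    HasMean P (fun ω => influence P G Z j l a b c (Z ω)) 0 := by
  have hres : ∀ {k m : Fin p}, k ≠ m → HasMean P (fun ω => residual P G Z k (Z ω k) * Z ω m) 0 :=
    fun {k m} hkm => hs.hasMean_comp_mul hZ hkm (measurable_residual k)
      ((hmom.memLp_residual hs hZ k).integrable one_le_two)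
  exact ((((hres hjl).const_mul a).add ((hres hjl.symm).const_mul b)).add
    ((hs.hasMean_mul hZ j l).const_mul c)).congr (fun _ => rfl) (by simp [hjl])

/-- The three summands of an influence function are orthogonal: the residual of a component is
orthogonal to the component itself. -/
theorem HasMoments.hasMean_influence_sq (hmom : HasMoments P G Z) (hs : IsStandardizedSource P Z)
    (hZ : Measurable Z) (hjl : j ≠ l) (a b c : ℝ) :
    HasMean P (fun ω => influence P G Z j l a b c (Z ω) ^ 2)
      (a ^ 2 * (sigmaSq P G (fun ω => Z ω j) - lam P G (fun ω => Z ω j) ^ 2)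
        + b ^ 2 * (sigmaSq P G (fun ω => Z ω l) - lam P G (fun ω => Z ω l) ^ 2) + c ^ 2) := by
  have hprod : ∀ {f h : ℝ → ℝ} {x y : ℝ}, Measurable f → Measurable h →
      HasMean P (fun ω => f (Z ω j)) x → HasMean P (fun ω => h (Z ω l)) y →
        HasMean P (fun ω => f (Z ω j) * h (Z ω l)) (x * y) := fun hf hh hX hY =>
    hX.mul_of_indepFun hY (hs.indepFun_comp hjl hf hh)
  have hsq : Measurable fun y : ℝ => y ^ 2 := measurable_id.pow_const 2
  have hmul : ∀ k, Measurable fun y => residual P G Z k y * y := fun k =>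
    (measurable_residual k).mul measurable_id
  have hressq : ∀ k, Measurable fun y => residual P G Z k y ^ 2 := fun k =>
    (measurable_residual k).pow_const 2
  have hz2 := hs.hasMean_sq
  have hr1 := hmom.hasMean_residual_mul_self hs hZ
  have hr2 := hmom.hasMean_residual_sq hs hZ
  have haa := (hprod (hressq j) hsq (hr2 j) (hz2 l)).const_mul (a ^ 2)
  have hbb := (hprod hsq (hressq l) (hz2 j) (hr2 l)).const_mul (b ^ 2)
  have hcc := (hprod hsq hsq (hz2 j) (hz2 l)).const_mul (c ^ 2)
  have hab := (hprod (hmul j) (hmul l) (hr1 j) (hr1 l)).const_mul (2 * a * b)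
  have hac := (hprod (hmul j) hsq (hr1 j) (hz2 l)).const_mul (2 * a * c)
  have hbc := (hprod hsq (hmul l) (hz2 j) (hr1 l)).const_mul (2 * b * c)
  refine (((((haa.add hbb).add hcc).add hab).add hac).add hbc).congr (fun ω => ?_) (by ring)
  simp only [influence]
  ring

end Moments

/-! ### First order solution of the estimating equations -/

section Rates

variable {A ι : Type*} {L : Filter A}

theorem isLittleO_mul_of_tendsto_zero {f g r : A → ℝ} (hf : Tendsto f L (𝓝 0)) (hg : g =O[L] r) :
    (fun q => f q * g q) =o[L] r := by
  simpa using ((isLittleO_one_iff ℝ).2 hf).mul_isBigO hg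

variable [Fintype ι]

/-- The rate `ρ` enlarged by the sizes of the members of the family `f`: the scale on which errors
are measured as long as the rate of `f` itself is unknown. -/
def augment (ρ : A → ℝ) (f : ι → A → ℝ) (q : A) : ℝ :=
  |ρ q| + ∑ i, |f i q|

variable {ρ r : A → ℝ} {f g : ι → A → ℝ}

theorem augment_nonneg (q : A) : 0 ≤ augment ρ f q :=
  add_nonneg (abs_nonneg _) (Finset.sum_nonneg fun _ _ => abs_nonneg _)

theorem isBigO_augment : ρ =O[L] augment ρ f :=
  IsBigO.of_norm_le fun _ => le_add_of_nonneg_right (Finset.sum_nonneg fun _ _ => abs_nonneg _)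

theorem isBigO_augment_apply (i : ι) : f i =O[L] augment ρ f :=
  IsBigO.of_norm_le fun q =>
    (Finset.single_le_sum (f := fun i => |f i q|) (fun _ _ => abs_nonneg _)
      (Finset.mem_univ i)).trans (le_add_of_nonneg_left (abs_nonneg _))

theorem augment_isBigO (hρ : ρ =O[L] r) (hf : ∀ i, f i =O[L] r) : augment ρ f =O[L] r :=
  hρ.abs_left.add (IsBigO.fun_sum fun i _ => (hf i).abs_left)

theorem augment_isBigO_of_isLittleO_sub (hg : ∀ i, g i =O[L] ρ)
    (hfg : ∀ i, (fun q => f i q - g i q) =o[L] augment ρ f) : augment ρ f =O[L] ρ := by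
  have hmain : (fun q => |ρ q| + ∑ i, |g i q|) =O[L] ρ := augment_isBigO (isBigO_refl ρ L) hg
  have herror : (fun q => ∑ i, |f i q - g i q|) =o[L] augment ρ f :=
    IsLittleO.fun_sum fun i _ => (hfg i).abs_left
  obtain ⟨C, hC⟩ := hmain.bound
  refine IsBigO.of_bound (2 * C) ?_
  filter_upwards [hC, herror.bound one_half_pos] with q hq hq'
  have htriangle : ∑ i, |f i q| ≤ ∑ i, |g i q| + ∑ i, |f i q - g i q| := by
    rw [← Finset.sum_add_distrib]
    exact Finset.sum_le_sum fun i _ => by simpa using abs_add_le (g i q) (f i q - g i q)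
  have hg_le := (le_abs_self _).trans hq
  have herror_le := (le_abs_self _).trans hq'
  rw [Real.norm_eq_abs (augment ρ f q), abs_of_nonneg (augment_nonneg q)] at herror_le ⊢
  simp only [augment] at herror_le ⊢
  linarith

end Rates

section FirstOrder

variable {A : Type*} {L : Filter A} {p : ℕ}

/-- The deviation of the entry `(j, m)` from the identity. -/
def dev (Γ : A → Matrix (Fin p) (Fin p) ℝ) (j m : Fin p) (q : A) : ℝ :=
  Γ q j m - (1 : Matrix (Fin p) (Fin p) ℝ) j m

/-- The size of the deviation of the row `j`, on top of the base rate `ρ`. -/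
abbrev rowScale (ρ : A → ℝ) (Γ : A → Matrix (Fin p) (Fin p) ℝ) (j : Fin p) : A → ℝ :=
  augment ρ (dev Γ j)

/-- The first order expansions, along `L` and with base rate `ρ`, of the covariance matrix `S`,
with linear term `C`, and of the vectors `T j`, the values of the estimating function at the rows of
`Γ`, with linear terms `Q j` and `δ j` times the deviation of the row. -/
structure IsFirstOrder (L : Filter A) (ρ : A → ℝ) (Γ S T : A → Matrix (Fin p) (Fin p) ℝ)
    (C Q : Fin p → Fin p → A → ℝ) (lm δ : Fin p → ℝ) : Prop where
  dev_tendsto : ∀ j m, Tendsto (dev Γ j m) L (𝓝 0)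
  rate_tendsto : Tendsto ρ L (𝓝 0)
  cov_symm : ∀ j m, C j m = C m j
  cov_isBigO : ∀ j m, C j m =O[L] ρ
  cov : ∀ j m, (fun q => dev S j m q - C j m q) =o[L] ρ
  score_isBigO : ∀ j m, j ≠ m → Q j m =O[L] ρ
  score : ∀ j m, j ≠ m → (fun q => T q j m - Q j m q - δ j * dev Γ j m q) =o[L] rowScale ρ Γ j
  score_tendsto : ∀ j m, Tendsto (fun q => T q j m) L
    (𝓝 (lm j * (1 : Matrix (Fin p) (Fin p) ℝ) j m))
  whitening : ∀ᶠ q in L, Γ q * S q * (Γ q)ᵀ = 1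

variable {ρ : A → ℝ} {Γ S T : A → Matrix (Fin p) (Fin p) ℝ} {C Q : Fin p → Fin p → A → ℝ}
  {lm δ : Fin p → ℝ}

theorem sum_dev_mul (q : A) (l : Fin p) (w : Fin p → ℝ) :
    ∑ m, dev Γ l m q * w m = Γ q l ⬝ᵥ w - w l := by
  simp [dev, sub_mul, Finset.sum_sub_distrib, dotProduct, Matrix.one_apply]

theorem dotProduct_mulVec_row (q : A) (l j : Fin p) :
    Γ q l ⬝ᵥ (S q *ᵥ Γ q j) = (Γ q * S q * (Γ q)ᵀ) l j := by
  rw [Matrix.mul_assoc]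
  simp [Matrix.mul_apply, dotProduct, Matrix.mulVec]

namespace IsFirstOrder

theorem dev_cov_isBigO (h : IsFirstOrder L ρ Γ S T C Q lm δ) (j m : Fin p) : dev S j m =O[L] ρ :=
  ((h.cov j m).isBigO.add (h.cov_isBigO j m)).congr_left fun q => by ring

theorem isLittleO_cov_mulVec (h : IsFirstOrder L ρ Γ S T C Q lm δ) (j l : Fin p) :
    (fun q => (S q *ᵥ Γ q j) l - (1 : Matrix (Fin p) (Fin p) ℝ) j l - dev Γ j l q - C j l q)
      =o[L] rowScale ρ Γ j := by
  have hsecond : (fun q => ∑ m, dev S l m q * dev Γ j m q) =o[L] rowScale ρ Γ j :=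
    IsLittleO.fun_sum fun m _ => isLittleO_mul_of_tendsto_zero
      ((h.dev_cov_isBigO l m).trans_tendsto h.rate_tendsto) (isBigO_augment_apply m)
  refine (((h.cov l j).trans_isBigO isBigO_augment).add hsecond).congr_left fun q => ?_
  have hdot : S q l ⬝ᵥ (fun m => dev Γ j m q) = (S q *ᵥ Γ q j) l - S q l j := by
    simp [dev, mul_sub, Finset.sum_sub_distrib, dotProduct, Matrix.mulVec, Matrix.one_apply]
  rw [h.cov_symm l j, sum_dev_mul, hdot]
  simp only [dev, Matrix.one_apply, eq_comm (a := l)]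
  ring

theorem isBigO_cov_mulVec (h : IsFirstOrder L ρ Γ S T C Q lm δ) (j l : Fin p) :
    (fun q => (S q *ᵥ Γ q j) l - (1 : Matrix (Fin p) (Fin p) ℝ) j l) =O[L] rowScale ρ Γ j :=
  (((h.isLittleO_cov_mulVec j l).isBigO.add (isBigO_augment_apply l)).add
    ((h.cov_isBigO j l).trans isBigO_augment)).congr_left fun q => by ring

/-- The whitening constraint fixes the symmetric part of the deviation. -/
theorem isLittleO_dev_add_dev (h : IsFirstOrder L ρ Γ S T C Q lm δ) (j l : Fin p) :
    (fun q => dev Γ l j q + dev Γ j l q + C j l q) =o[L] rowScale ρ Γ j := by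
  have hsecond : (fun q => ∑ m, dev Γ l m q
      * ((S q *ᵥ Γ q j) m - (1 : Matrix (Fin p) (Fin p) ℝ) j m)) =o[L] rowScale ρ Γ j :=
    IsLittleO.fun_sum fun m _ =>
      isLittleO_mul_of_tendsto_zero (h.dev_tendsto l m) (h.isBigO_cov_mulVec j m)
  refine (hsecond.neg_left.sub (h.isLittleO_cov_mulVec j l)).congr' ?_ EventuallyEq.rfl
  filter_upwards [h.whitening] with q hq
  have hdot : Γ q l ⬝ᵥ (1 : Matrix (Fin p) (Fin p) ℝ) j = Γ q l j := by
    simp [dotProduct, Matrix.one_apply]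
  rw [sum_dev_mul q l (fun m => (S q *ᵥ Γ q j) m - (1 : Matrix (Fin p) (Fin p) ℝ) j m)]
  change -(Γ q l ⬝ᵥ (S q *ᵥ Γ q j - (1 : Matrix (Fin p) (Fin p) ℝ) j) - _) - _ = _
  rw [dotProduct_sub, dotProduct_mulVec_row, hq, hdot]
  simp only [dev]
  ring

theorem isLittleO_dev_self (h : IsFirstOrder L ρ Γ S T C Q lm δ) (j : Fin p) :
    (fun q => dev Γ j j q - -1 / 2 * C j j q) =o[L] rowScale ρ Γ j :=
  ((h.isLittleO_dev_add_dev j j).const_mul_left (1 / 2)).congr_left fun q => by ring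

theorem score_sub_tendsto (h : IsFirstOrder L ρ Γ S T C Q lm δ) (j m : Fin p) :
    Tendsto (fun q => T q j m - lm j * (1 : Matrix (Fin p) (Fin p) ℝ) j m) L (𝓝 0) := by
  simpa using (h.score_tendsto j m).sub_const (lm j * (1 : Matrix (Fin p) (Fin p) ℝ) j m)

theorem dot_score_eq (q : A) (j l : Fin p) :
    Γ q l ⬝ᵥ T q j = T q j l + lm j * dev Γ l j q
      + ∑ m, dev Γ l m q * (T q j m - lm j * (1 : Matrix (Fin p) (Fin p) ℝ) j m) := by
  have hdev : ∑ m, dev Γ l m q * (lm j * (1 : Matrix (Fin p) (Fin p) ℝ) j m)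
      = lm j * dev Γ l j q := by
    simp [Matrix.one_apply, mul_comm]
  simp only [mul_sub, Finset.sum_sub_distrib]
  rw [hdev, sum_dev_mul]
  ring

theorem isLittleO_dot_score (h : IsFirstOrder L ρ Γ S T C Q lm δ) {j l : Fin p} (hjl : j ≠ l)
    {r : A → ℝ} (hj : rowScale ρ Γ j =O[L] r) (hl : rowScale ρ Γ l =O[L] r) :
    (fun q => Γ q l ⬝ᵥ T q j - (Q j l q + δ j * dev Γ j l q + lm j * dev Γ l j q)) =o[L] r := by
  have hsecond : (fun q => ∑ m, dev Γ l m q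
      * (T q j m - lm j * (1 : Matrix (Fin p) (Fin p) ℝ) j m)) =o[L] r :=
    IsLittleO.fun_sum fun m _ => (isLittleO_mul_of_tendsto_zero (h.score_sub_tendsto j m)
      ((isBigO_augment_apply m).trans hl)).congr_left fun q => mul_comm _ _
  refine (((h.score j l hjl).trans_isBigO hj).add hsecond).congr_left fun q => ?_
  rw [dot_score_eq (lm := lm)]
  ring

theorem tendsto_dot_score (h : IsFirstOrder L ρ Γ S T C Q lm δ) (j l : Fin p) :
    Tendsto (fun q => Γ q l ⬝ᵥ T q j) L (𝓝 (lm j * (1 : Matrix (Fin p) (Fin p) ℝ) j l)) := by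
  have hsecond : Tendsto (fun q => ∑ m, dev Γ l m q
      * (T q j m - lm j * (1 : Matrix (Fin p) (Fin p) ℝ) j m)) L (𝓝 0) := by
    simpa using tendsto_finsetSum Finset.univ fun m _ =>
      (h.dev_tendsto l m).mul (h.score_sub_tendsto j m)
  have hsum := ((h.score_tendsto j l).add ((h.dev_tendsto l j).const_mul (lm j))).add hsecond
  simp only [mul_zero, add_zero] at hsum
  exact hsum.congr fun q => (dot_score_eq q j l).symm

/-! #### Sequential extraction -/

theorem score_eq_of_deflation {q : A} {j : Fin p}
    (hq : T q j = (S q * ∑ m ∈ Finset.Iic j, Matrix.vecMulVec (Γ q m) (Γ q m)) *ᵥ T q j)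
    (l : Fin p) :
    T q j l = ∑ m ∈ Finset.Iio j, (Γ q m ⬝ᵥ T q j) * (S q *ᵥ Γ q m) l
      + (Γ q j ⬝ᵥ T q j) * (S q *ᵥ Γ q j) l := by
  have hIic : T q j l = ∑ m ∈ Finset.Iic j, (Γ q m ⬝ᵥ T q j) * (S q *ᵥ Γ q m) l := by
    conv_lhs => rw [hq]
    rw [← Matrix.mulVec_mulVec, Matrix.sum_mulVec, Matrix.mulVec_sum, Finset.sum_apply]
    refine Finset.sum_congr rfl fun m _ => ?_
    rw [Matrix.vecMulVec_mulVec]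
    simp [Matrix.mulVec_smul]
  rw [hIic, ← Finset.Iio_insert, Finset.sum_insert (by simp), add_comm]

theorem isLittleO_deflation_row (h : IsFirstOrder L ρ Γ S T C Q lm δ) {j l : Fin p} (hjl : j < l)
    (heq : ∀ᶠ q in L, T q j
      = (S q * ∑ m ∈ Finset.Iic j, Matrix.vecMulVec (Γ q m) (Γ q m)) *ᵥ T q j)
    (hprev : ∀ m < j, rowScale ρ Γ m =O[L] ρ) :
    (fun q => (lm j - δ j) * dev Γ j l q - (Q j l q - lm j * C j l q)) =o[L] rowScale ρ Γ j := by
  have hu : ∀ m < l, (fun q => (S q *ᵥ Γ q m) l) =O[L] rowScale ρ Γ m := fun m hm => by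
    simpa [Matrix.one_apply_ne hm.ne] using h.isBigO_cov_mulVec m l
  have hearlier : (fun q => ∑ m ∈ Finset.Iio j, (Γ q m ⬝ᵥ T q j) * (S q *ᵥ Γ q m) l)
      =o[L] rowScale ρ Γ j := by
    refine IsLittleO.fun_sum fun m hm => ?_
    have hmj := Finset.mem_Iio.1 hm
    refine (isLittleO_mul_of_tendsto_zero ?_
      ((hu m (hmj.trans hjl)).trans (hprev m hmj))).trans_isBigO isBigO_augment
    simpa [Matrix.one_apply_ne hmj.ne'] using h.tendsto_dot_score j m
  have hown : (fun q => (Γ q j ⬝ᵥ T q j - lm j) * (S q *ᵥ Γ q j) l) =o[L] rowScale ρ Γ j := by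
    refine isLittleO_mul_of_tendsto_zero ?_ (hu j hjl)
    simpa using (h.tendsto_dot_score j j).sub_const (lm j)
  have hcov := (h.isLittleO_cov_mulVec j l).const_mul_left (lm j)
  refine ((((h.score j l hjl.ne).sub hearlier).sub hown).sub hcov).congr' ?_ EventuallyEq.rfl
  filter_upwards [heq] with q hq
  rw [Matrix.one_apply_ne hjl.ne, score_eq_of_deflation hq l]
  ring

theorem rowScale_isBigO_of_deflation (h : IsFirstOrder L ρ Γ S T C Q lm δ)
    (heq : ∀ᶠ q in L, ∀ j, T q j
      = (S q * ∑ m ∈ Finset.Iic j, Matrix.vecMulVec (Γ q m) (Γ q m)) *ᵥ T q j)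
    (j : Fin p) (hj : ∀ k ≤ j, lm k ≠ δ k) : rowScale ρ Γ j =O[L] ρ := by
  induction j using WellFoundedLT.induction with
  | ind j ih =>
    have hprev : ∀ m < j, rowScale ρ Γ m =O[L] ρ := fun m hm =>
      ih m hm fun k hk => hj k (hk.trans hm.le)
    have hlinear : ∀ m, ∃ g : A → ℝ, g =O[L] ρ ∧
        (fun q => dev Γ j m q - g q) =o[L] rowScale ρ Γ j := by
      intro m
      rcases lt_trichotomy m j with hm | rfl | hm
      · refine ⟨fun q => -C m j q - dev Γ m j q, (h.cov_isBigO m j).neg_left.sub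
          ((isBigO_augment_apply j).trans (hprev m hm)), ?_⟩
        exact (((h.isLittleO_dev_add_dev m j).trans_isBigO (hprev m hm)).trans_isBigO
          isBigO_augment).congr_left fun q => by ring
      · exact ⟨_, (h.cov_isBigO m m).const_mul_left _, h.isLittleO_dev_self m⟩
      · refine ⟨fun q => (lm j - δ j)⁻¹ * (Q j m q - lm j * C j m q),
          ((h.score_isBigO j m hm.ne).sub ((h.cov_isBigO j m).const_mul_left _)).const_mul_left _,
          ?_⟩
        refine ((h.isLittleO_deflation_row hm (heq.mono fun q hq => hq j) hprev).const_mul_left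
          (lm j - δ j)⁻¹).congr_left fun q => ?_
        have := sub_ne_zero.2 (hj j le_rfl)
        field_simp
    choose g hg hfg using hlinear
    exact augment_isBigO_of_isLittleO_sub hg hfg

theorem isLittleO_deflation (h : IsFirstOrder L ρ Γ S T C Q lm δ)
    (heq : ∀ᶠ q in L, ∀ j, T q j
      = (S q * ∑ m ∈ Finset.Iic j, Matrix.vecMulVec (Γ q m) (Γ q m)) *ᵥ T q j)
    {j l : Fin p} (hjl : j < l) (hj : ∀ k ≤ j, lm k ≠ δ k) :
    (fun q => dev Γ j l q - (lm j - δ j)⁻¹ * (Q j l q - lm j * C j l q)) =o[L] ρ := by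
  have hrow := (h.isLittleO_deflation_row hjl (heq.mono fun q hq => hq j) fun m hm =>
    h.rowScale_isBigO_of_deflation heq m fun k hk => hj k (hk.trans hm.le)).trans_isBigO
      (h.rowScale_isBigO_of_deflation heq j hj)
  have hne := sub_ne_zero.2 (hj j le_rfl)
  refine (hrow.const_mul_left (lm j - δ j)⁻¹).congr_left fun q => ?_
  field_simp

theorem isLittleO_deflation_swap (h : IsFirstOrder L ρ Γ S T C Q lm δ)
    (heq : ∀ᶠ q in L, ∀ j, T q j
      = (S q * ∑ m ∈ Finset.Iic j, Matrix.vecMulVec (Γ q m) (Γ q m)) *ᵥ T q j)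
    {j l : Fin p} (hjl : j < l) (hj : ∀ k ≤ j, lm k ≠ δ k) :
    (fun q => dev Γ l j q - (-(lm j - δ j)⁻¹ * (Q j l q - lm j * C j l q) - C j l q))
      =o[L] ρ :=
  (((h.isLittleO_dev_add_dev j l).trans_isBigO (h.rowScale_isBigO_of_deflation heq j hj)).sub
    (h.isLittleO_deflation heq hjl hj)).congr_left fun q => by ring

/-! #### Simultaneous extraction -/

theorem isLittleO_symmetric_pair (h : IsFirstOrder L ρ Γ S T C Q lm δ) {a : Fin p → A → ℝ}
    {β : Fin p → ℝ} (ha : ∀ j, a j =O[L] fun _ => (1 : ℝ))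
    (hβ : ∀ j, Tendsto (fun q => a j q * (lm j - δ j)) L (𝓝 (β j)))
    (heq : ∀ᶠ q in L, ∀ j l, a j q * (Γ q l ⬝ᵥ T q j) = a l q * (Γ q j ⬝ᵥ T q l))
    {j l : Fin p} (hjl : j ≠ l) {r : A → ℝ}
    (hj : rowScale ρ Γ j =O[L] r) (hl : rowScale ρ Γ l =O[L] r) :
    (fun q => (β j + β l) * dev Γ j l q
      - (a j q * (Q j l q - lm j * C j l q) - a l q * (Q l j q - δ l * C j l q))) =o[L] r := by
  have hwhite := (h.isLittleO_dev_add_dev j l).trans_isBigO hj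
  have hdev := (isBigO_augment_apply (L := L) (ρ := ρ) (f := dev Γ j) l).trans hj
  have hβ0 : ∀ k, Tendsto (fun q => a k q * (lm k - δ k) - β k) L (𝓝 0) := fun k => by
    simpa using (hβ k).sub_const (β k)
  have hmul : ∀ (k : Fin p) {f : A → ℝ}, f =o[L] r → (fun q => a k q * f q) =o[L] r :=
    fun k f hf => by simpa using (ha k).mul_isLittleO hf
  have hleft := hmul j ((hwhite.const_mul_left (lm j)).add (h.isLittleO_dot_score hjl hj hl))
  have hright := hmul l ((hwhite.const_mul_left (δ l)).add (h.isLittleO_dot_score hjl.symm hl hj))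
  have hj0 := isLittleO_mul_of_tendsto_zero (hβ0 j) hdev
  have hl0 := isLittleO_mul_of_tendsto_zero (hβ0 l) hdev
  refine (((hleft.sub hright).sub hj0).sub hl0).congr' ?_ EventuallyEq.rfl
  filter_upwards [heq] with q hq
  linear_combination hq j l

theorem isBigO_symmetric_lead (h : IsFirstOrder L ρ Γ S T C Q lm δ) {a : Fin p → A → ℝ}
    (ha : ∀ j, a j =O[L] fun _ => (1 : ℝ)) {j l : Fin p} (hjl : j ≠ l) :
    (fun q => a j q * (Q j l q - lm j * C j l q) - a l q * (Q l j q - δ l * C j l q))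
      =O[L] ρ := by
  have hj := (h.score_isBigO j l hjl).sub ((h.cov_isBigO j l).const_mul_left (lm j))
  have hl := (h.score_isBigO l j hjl.symm).sub ((h.cov_isBigO j l).const_mul_left (δ l))
  simpa using ((ha j).mul hj).sub ((ha l).mul hl)

theorem rowScale_isBigO_of_symmetric (h : IsFirstOrder L ρ Γ S T C Q lm δ) {a : Fin p → A → ℝ}
    {β : Fin p → ℝ} (ha : ∀ j, a j =O[L] fun _ => (1 : ℝ))
    (hβ : ∀ j, Tendsto (fun q => a j q * (lm j - δ j)) L (𝓝 (β j)))
    (hne : ∀ j l, j ≠ l → β j + β l ≠ 0)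
    (heq : ∀ᶠ q in L, ∀ j l, a j q * (Γ q l ⬝ᵥ T q j) = a l q * (Γ q j ⬝ᵥ T q l)) (j : Fin p) :
    rowScale ρ Γ j =O[L] ρ := by
  set r : A → ℝ := augment ρ fun i : Fin p × Fin p => dev Γ i.1 i.2
  have hrow : ∀ j, rowScale ρ Γ j =O[L] r := fun j => augment_isBigO isBigO_augment fun m =>
    isBigO_augment_apply (f := fun i : Fin p × Fin p => dev Γ i.1 i.2) (j, m)
  have hlinear : ∀ i : Fin p × Fin p, ∃ g : A → ℝ, g =O[L] ρ ∧
      (fun q => dev Γ i.1 i.2 q - g q) =o[L] r := by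
    rintro ⟨j, l⟩
    by_cases hjl : j = l
    · subst hjl
      exact ⟨_, (h.cov_isBigO j j).const_mul_left _, (h.isLittleO_dev_self j).trans_isBigO (hrow j)⟩
    · refine ⟨_, (h.isBigO_symmetric_lead ha hjl).const_mul_left (β j + β l)⁻¹, ?_⟩
      refine ((h.isLittleO_symmetric_pair ha hβ heq hjl (hrow j) (hrow l)).const_mul_left
        (β j + β l)⁻¹).congr_left fun q => ?_
      have := hne j l hjl
      field_simp
  choose g hg hfg using hlinear
  exact (hrow j).trans (augment_isBigO_of_isLittleO_sub hg hfg)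

theorem isLittleO_symmetric (h : IsFirstOrder L ρ Γ S T C Q lm δ) {a : Fin p → A → ℝ}
    {β : Fin p → ℝ} (ha : ∀ j, a j =O[L] fun _ => (1 : ℝ))
    (hβ : ∀ j, Tendsto (fun q => a j q * (lm j - δ j)) L (𝓝 (β j)))
    (hne : ∀ j l, j ≠ l → β j + β l ≠ 0)
    (heq : ∀ᶠ q in L, ∀ j l, a j q * (Γ q l ⬝ᵥ T q j) = a l q * (Γ q j ⬝ᵥ T q l))
    {j l : Fin p} (hjl : j ≠ l) {b c : ℝ} (hb : Tendsto (a j) L (𝓝 b))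
    (hc : Tendsto (a l) L (𝓝 c)) :
    (fun q => dev Γ j l q - (β j + β l)⁻¹ * (b * (Q j l q - lm j * C j l q)
      - c * (Q l j q - δ l * C j l q))) =o[L] ρ := by
  have hrow := h.rowScale_isBigO_of_symmetric ha hβ hne heq
  have hpair := h.isLittleO_symmetric_pair ha hβ heq hjl (hrow j) (hrow l)
  have hb0 : Tendsto (fun q => a j q - b) L (𝓝 0) := by simpa using hb.sub_const b
  have hc0 : Tendsto (fun q => a l q - c) L (𝓝 0) := by simpa using hc.sub_const c
  have hj := isLittleO_mul_of_tendsto_zero hb0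
    ((h.score_isBigO j l hjl).sub ((h.cov_isBigO j l).const_mul_left (lm j)))
  have hl := isLittleO_mul_of_tendsto_zero hc0
    ((h.score_isBigO l j hjl.symm).sub ((h.cov_isBigO j l).const_mul_left (δ l)))
  refine (((hpair.add hj).sub hl).const_mul_left (β j + β l)⁻¹).congr_left fun q => ?_
  have := hne j l hjl
  field_simp
  ring

end IsFirstOrder

end FirstOrder

/-! ### The statistics satisfy the first order expansions -/

section SampleExpansion

variable {Ω : Type*} {p : ℕ} {z x : ℕ → Ω → Fin p → ℝ} {loc : Fin p → ℝ} {G : ℝ → ℝ}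
  {ρ : ℕ × Ω → ℝ} {Γ : ℕ × Ω → Matrix (Fin p) (Fin p) ℝ}

theorem weight_le_weight_sq (v : Fin p → ℝ) : weight v ≤ weight v ^ 2 :=
  le_self_pow₀ (one_le_weight v) two_ne_zero

theorem abs_mul_le_weight_sq (m : Fin p) {φ : (Fin p → ℝ) → ℝ} (hφw : ∀ v, |φ v| ≤ weight v)
    (v : Fin p → ℝ) : |v m * φ v| ≤ weight v ^ 2 := by
  rw [abs_mul, sq]
  exact mul_le_mul (abs_le_weight v m) (hφw v) (abs_nonneg _) (weight_pos v).le

/-- The centred second moments of the latent vectors. -/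
noncomputable def covTerm (z : ℕ → Ω → Fin p → ℝ) (j m : Fin p) : ℕ × Ω → ℝ :=
  empMean z fun v => v j * v m - (1 : Matrix (Fin p) (Fin p) ℝ) j m

theorem covTerm_comm (j m : Fin p) : covTerm z j m = covTerm z m j := by
  simp only [covTerm, mul_comm, Matrix.one_apply, eq_comm]

variable [MeasurableSpace Ω] {P : Measure Ω}

/-- The leading term of the statistic `T` in the direction `e j`. -/
noncomputable def scoreTerm (P : Measure Ω) (G : ℝ → ℝ) (z : ℕ → Ω → Fin p → ℝ) (j m : Fin p) :
    ℕ × Ω → ℝ :=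
  empMean z fun v => (deriv G (v j) - ∫ ω, deriv G (z 0 ω j) ∂P) * v m

theorem scoreTerm_eq (j m : Fin p) (q : ℕ × Ω) :
    scoreTerm P G z j m q = empMean z (fun v => deriv G (v j) * v m) q
      - (∫ ω, deriv G (z 0 ω j) ∂P) * latentMean z q m := by
  simp only [scoreTerm, sub_mul]
  rw [empMean_sub, empMean_const_mul, latentMean]

/-- `ρ` is a rate of order `n ^ (-1/2)` in probability that dominates all leading terms of the
statistics. -/
structure IsCommonRate (P : Measure Ω) (G : ℝ → ℝ) (z : ℕ → Ω → Fin p → ℝ) (ρ : ℕ × Ω → ℝ) :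
    Prop where
  mean_isBigO : ∀ k, (fun q => latentMean z q k) =O[probFilter P] ρ
  cov_isBigO : ∀ j m, covTerm z j m =O[probFilter P] ρ
  score_isBigO : ∀ j m, j ≠ m → scoreTerm P G z j m =O[probFilter P] ρ
  tendsto_zero : Tendsto ρ (probFilter P) (𝓝 0)
  negligible : ∀ h : ℕ × Ω → ℝ, h =o[probFilter P] ρ →
    Tendsto (fun q => √(q.1 : ℝ) * h q) (probFilter P) (𝓝 0)

namespace IsCommonRate

theorem tendsto_latentMean (hρ : IsCommonRate P G z ρ) (k : Fin p) :
    Tendsto (fun q => latentMean z q k) (probFilter P) (𝓝 0) :=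
  (hρ.mean_isBigO k).trans_tendsto hρ.tendsto_zero

theorem shift_isBigO (hρ : IsCommonRate P G z ρ)
    (hΓ : ∀ j m, Tendsto (dev Γ j m) (probFilter P) (𝓝 0)) (j : Fin p) :
    (fun q => shift z (Γ q j) q) =O[probFilter P] ρ := by
  refine IsBigO.neg_left (IsBigO.fun_sum fun m _ => ?_)
  have hentry : Tendsto (fun q => Γ q j m) (probFilter P)
      (𝓝 ((1 : Matrix (Fin p) (Fin p) ℝ) j m)) := by
    simpa [dev] using (hΓ j m).add_const ((1 : Matrix (Fin p) (Fin p) ℝ) j m)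
  simpa using (hentry.isBigO_one ℝ).mul (hρ.mean_isBigO m)

theorem tendsto_shift (hρ : IsCommonRate P G z ρ)
    (hΓ : ∀ j m, Tendsto (dev Γ j m) (probFilter P) (𝓝 0)) (j : Fin p) :
    Tendsto (fun q => shift z (Γ q j) q) (probFilter P) (𝓝 0) :=
  (hρ.shift_isBigO hΓ j).trans_tendsto hρ.tendsto_zero

theorem formDist_isBigO (hρ : IsCommonRate P G z ρ)
    (hΓ : ∀ j m, Tendsto (dev Γ j m) (probFilter P) (𝓝 0)) (j : Fin p) :
    (fun q => formDist j (Γ q j) (shift z (Γ q j) q)) =O[probFilter P] rowScale ρ Γ j :=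
  (IsBigO.fun_sum fun m _ => (isBigO_augment_apply (f := dev Γ j) m).abs_left).add
    ((hρ.shift_isBigO hΓ j).abs_left.trans isBigO_augment)

theorem isLittleO_sampleCov (hρ : IsCommonRate P G z ρ) (hx : ∀ i ω, x i ω = loc + z i ω)
    (j m : Fin p) :
    (fun q => dev (fun q => sampleCov q.1 fun i => x i q.2) j m q - covTerm z j m q)
      =o[probFilter P] ρ := by
  refine (isLittleO_mul_of_tendsto_zero (hρ.tendsto_latentMean j)
    (hρ.mean_isBigO m)).neg_left.congr' ?_ EventuallyEq.rfl
  filter_upwards [eventually_pos_probFilter] with q hq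
  rw [dev, sampleCov_apply hx hq, covTerm, empMean_sub, empMean_const hq]
  ring

end IsCommonRate

variable [IsProbabilityMeasure P]

theorem HasMoments.integrable_nonlin_mul_weight {Z : Ω → Fin p → ℝ} (hmom : HasMoments P G Z)
    (hs : IsStandardizedSource P Z) (hZ : Measurable Z) (k : Fin p) :
    Integrable (fun ω => deriv G (Z ω k) * weight (Z ω)) P := by
  simp only [weight, mul_add, mul_one, Finset.mul_sum]
  refine ((hmom.nonlin k).integrable one_le_two).add (integrable_finsetSum _ fun m _ => ?_)
  have hmeas : Measurable fun ω => deriv G (Z ω k) * |Z ω m| :=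
    ((measurable_deriv G).comp ((measurable_pi_apply k).comp hZ)).mul
      ((measurable_pi_apply m).comp hZ).abs
  exact (hmom.hasMean_nonlin_mul hs hZ k m).1.mono hmeas.aestronglyMeasurable
    (Eventually.of_forall fun ω => by simp)

theorem IsIIDSample.tight_latentMean (hz : IsIIDSample P z) (hs : IsStandardizedSource P (z 0))
    (k : Fin p) : Tight P fun q => √(q.1 : ℝ) * latentMean z q k :=
  hz.tight_empMean (measurable_pi_apply k) (hs.memLp (hz.measurable 0) k) (hs.mean_zero k)

theorem IsIIDSample.tight_covTerm (hz : IsIIDSample P z) (hs : IsStandardizedSource P (z 0))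
    (hmom : HasMoments P G (z 0)) (j m : Fin p) :
    Tight P fun q => √(q.1 : ℝ) * covTerm z j m q := by
  have hmean := (hs.hasMean_mul (hz.measurable 0) j m).sub
    (hasMean_const (P := P) ((1 : Matrix (Fin p) (Fin p) ℝ) j m))
  exact hz.tight_empMean (by fun_prop)
    ((hmom.memLp_mul hs (hz.measurable 0) j m).sub (memLp_const _))
    (hmean.2.trans (sub_self _))

theorem IsIIDSample.tight_scoreTerm (hz : IsIIDSample P z) (hs : IsStandardizedSource P (z 0))
    (hmom : HasMoments P G (z 0)) {j m : Fin p} (hjm : j ≠ m) :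
    Tight P fun q => √(q.1 : ℝ) * scoreTerm P G z j m q := by
  set c := ∫ ω, deriv G (z 0 ω j) ∂P
  have hg : Measurable fun y => deriv G y - c := (measurable_deriv G).sub_const c
  have hL2 : MemLp (fun ω => deriv G (z 0 ω j) - c) 2 P := (hmom.nonlin j).sub (memLp_const c)
  exact hz.tight_empMean (by fun_prop)
    (memLp_two_mul_of_indepFun hL2 (hs.memLp (hz.measurable 0) m)
      (hs.indepFun_comp hjm hg measurable_id))
    (hs.hasMean_comp_mul (hz.measurable 0) hjm hg (hL2.integrable one_le_two)).2

theorem exists_isCommonRate (hz : IsIIDSample P z) (hs : IsStandardizedSource P (z 0))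
    (hmom : HasMoments P G (z 0)) : ∃ ρ, IsCommonRate P G z ρ := by
  obtain ⟨ρ, hρ, hρ0, hρh⟩ := exists_rate (P := P)
    (ι := Fin p ⊕ (Fin p × Fin p) ⊕ {i : Fin p × Fin p // i.1 ≠ i.2})
    (f := Sum.elim (fun k q => latentMean z q k)
      (Sum.elim (fun i => covTerm z i.1 i.2) fun i => scoreTerm P G z i.1.1 i.1.2))
    (by
      rintro (k | i | i)
      exacts [hz.tight_latentMean hs k, hz.tight_covTerm hs hmom i.1 i.2,
        hz.tight_scoreTerm hs hmom i.2])
  exact ⟨ρ, fun k => hρ (.inl k), fun j m => hρ (.inr (.inl (j, m))),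
    fun j m hjm => hρ (.inr (.inr ⟨(j, m), hjm⟩)), hρ0, hρh⟩

theorem IsIIDSample.tendsto_empMean_deriv_mul (hz : IsIIDSample P z)
    (hdom : LocallyDominated P G (z 0)) (k : Fin p) {φ : (Fin p → ℝ) → ℝ} (hφ : Measurable φ)
    (hφw : ∀ v, |φ v| ≤ weight v ^ 2) :
    Tendsto (empMean z fun v => deriv (deriv G) (v k) * φ v) (probFilter P)
      (𝓝 (∫ ω, deriv (deriv G) (z 0 ω k) * φ (z 0 ω) ∂P)) :=
  hz.tendsto_empMean (((measurable_deriv _).comp (measurable_pi_apply k)).mul hφ)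
    ⟨hdom.integrable_deriv_mul (hz.measurable 0) k hφ hφw, rfl⟩

theorem tendsto_empMean_nonlin (hG : ContDiff ℝ 2 G) (hz : IsIIDSample P z)
    (hdom : LocallyDominated P G (z 0)) {U : ℕ × Ω → Fin p → ℝ} {t : ℕ × Ω → ℝ} {k : Fin p}
    (hU : ∀ m, Tendsto (fun q => U q m - (1 : Matrix (Fin p) (Fin p) ℝ) k m) (probFilter P) (𝓝 0))
    (ht : Tendsto t (probFilter P) (𝓝 0)) {φ : (Fin p → ℝ) → ℝ} (hφ : Measurable φ)
    (hφw : ∀ v, |φ v| ≤ weight v) {a : ℝ}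
    (ha : HasMean P (fun ω => deriv G (z 0 ω k) * φ (z 0 ω)) a) :
    Tendsto (fun q => empMean z (fun v => deriv G (U q ⬝ᵥ v + t q) * φ v) q) (probFilter P)
      (𝓝 a) := by
  have hremainder := (isLittleO_empMean_taylor hG hz hdom hU ht hφw).trans_tendsto
    (tendsto_formDist hU ht)
  have hmain := hz.tendsto_empMean (ψ := fun v => deriv G (v k) * φ v)
    (((measurable_deriv G).comp (measurable_pi_apply k)).mul hφ) ha
  have hrow := tendsto_finsetSum Finset.univ fun m _ => (hU m).mul
    (hz.tendsto_empMean_deriv_mul hdom k (φ := fun v => v m * φ v)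
      ((measurable_pi_apply m).mul hφ) (abs_mul_le_weight_sq m hφw))
  have hshift := ht.mul (hz.tendsto_empMean_deriv_mul hdom k hφ
    fun v => (hφw v).trans (weight_le_weight_sq v))
  have hsum := (hremainder.add (hrow.add hshift)).add hmain
  simp only [zero_mul, Finset.sum_const_zero, zero_add] at hsum
  exact hsum.congr fun q => by ring

namespace IsCommonRate

theorem tendsto_sampleG (hρ : IsCommonRate P G z ρ) (hG : ContDiff ℝ 2 G)
    (hx : ∀ i ω, x i ω = loc + z i ω) (hz : IsIIDSample P z) (hs : IsStandardizedSource P (z 0))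
    (hmom : HasMoments P G (z 0)) (hdom : LocallyDominated P G (z 0))
    (hΓ : ∀ j m, Tendsto (dev Γ j m) (probFilter P) (𝓝 0)) (j : Fin p) :
    Tendsto (fun q => sampleG G q.1 (fun i => x i q.2) (Γ q j)) (probFilter P)
      (𝓝 (nu P G fun ω => z 0 ω j)) := by
  refine (tendsto_empMean_contrast hG hz hdom (hmom.contrast j)
    (hmom.integrable_nonlin_mul_weight hs (hz.measurable 0) j) (hΓ j)
    (hρ.tendsto_shift hΓ j)).congr' ?_
  filter_upwards [eventually_pos_probFilter] with q hq
  rw [sampleG_eq hx hq]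

theorem tendsto_empMean_nonlin_shift (hρ : IsCommonRate P G z ρ) (hG : ContDiff ℝ 2 G)
    (hz : IsIIDSample P z) (hmom : HasMoments P G (z 0)) (hdom : LocallyDominated P G (z 0))
    (hΓ : ∀ j m, Tendsto (dev Γ j m) (probFilter P) (𝓝 0)) (j : Fin p) :
    Tendsto (fun q => empMean z (fun v => deriv G (Γ q j ⬝ᵥ v + shift z (Γ q j) q) * 1) q)
      (probFilter P) (𝓝 (∫ ω, deriv G (z 0 ω j) ∂P)) :=
  tendsto_empMean_nonlin hG hz hdom (hΓ j) (hρ.tendsto_shift hΓ j) (φ := fun _ => 1)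
    measurable_const (fun v => by simpa using one_le_weight v)
    (by simpa only [mul_one] using ⟨(hmom.nonlin j).integrable one_le_two, rfl⟩)

theorem tendsto_sampleT (hρ : IsCommonRate P G z ρ) (hG : ContDiff ℝ 2 G)
    (hx : ∀ i ω, x i ω = loc + z i ω) (hz : IsIIDSample P z) (hs : IsStandardizedSource P (z 0))
    (hmom : HasMoments P G (z 0)) (hdom : LocallyDominated P G (z 0))
    (hΓ : ∀ j m, Tendsto (dev Γ j m) (probFilter P) (𝓝 0)) (j m : Fin p) :
    Tendsto (fun q => sampleT G q.1 (fun i => x i q.2) (Γ q j) m) (probFilter P)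
      (𝓝 (lam P G (fun ω => z 0 ω j) * (1 : Matrix (Fin p) (Fin p) ℝ) j m)) := by
  have hmain := tendsto_empMean_nonlin hG hz hdom (hΓ j) (hρ.tendsto_shift hΓ j)
    (measurable_pi_apply m) (fun v => abs_le_weight v m)
    (hmom.hasMean_nonlin_mul hs (hz.measurable 0) j m)
  have hcentre := hmain.sub ((hρ.tendsto_latentMean m).mul
    (hρ.tendsto_empMean_nonlin_shift hG hz hmom hdom hΓ j))
  rw [zero_mul, sub_zero] at hcentre
  refine hcentre.congr' ?_
  filter_upwards [eventually_pos_probFilter] with q hq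
  rw [sampleT_apply hx hq]

/-- In the linear term only the deviation in the direction `l` survives: by independence, the
derivatives in the other directions and in the shift have mean zero. -/
theorem isLittleO_empMean_nonlin (hρ : IsCommonRate P G z ρ) (hG : ContDiff ℝ 2 G)
    (hz : IsIIDSample P z) (hs : IsStandardizedSource P (z 0)) (hmom : HasMoments P G (z 0))
    (hdom : LocallyDominated P G (z 0)) (hΓ : ∀ j m, Tendsto (dev Γ j m) (probFilter P) (𝓝 0))
    {j l : Fin p} (hjl : j ≠ l) :
    (fun q => empMean z (fun v => deriv G (Γ q j ⬝ᵥ v + shift z (Γ q j) q) * v l) q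
      - empMean z (fun v => deriv G (v j) * v l) q - del P G (fun ω => z 0 ω j) * dev Γ j l q)
      =o[probFilter P] rowScale ρ Γ j := by
  have := measurable_deriv (deriv G)
  have htaylor := (isLittleO_empMean_taylor hG hz hdom (hΓ j) (hρ.tendsto_shift hΓ j)
    (fun v => abs_le_weight v l)).trans_isBigO (hρ.formDist_isBigO hΓ j)
  have hrow : (fun q => ∑ m, (empMean z (fun v => deriv (deriv G) (v j) * (v m * v l)) q
        - del P G (fun ω => z 0 ω j) * (1 : Matrix (Fin p) (Fin p) ℝ) m l) * dev Γ j m q)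
      =o[probFilter P] rowScale ρ Γ j := by
    refine IsLittleO.fun_sum fun m _ => isLittleO_mul_of_tendsto_zero ?_ (isBigO_augment_apply m)
    exact tendsto_sub_nhds_zero_iff.2 (hz.tendsto_empMean
      (ψ := fun v => deriv (deriv G) (v j) * (v m * v l)) (by fun_prop)
      (hmom.hasMean_deriv_nonlin_mul_mul hs (hz.measurable 0) hjl m))
  have hshift : (fun q => empMean z (fun v => deriv (deriv G) (v j) * v l) q
      * shift z (Γ q j) q) =o[probFilter P] rowScale ρ Γ j :=
    (isLittleO_mul_of_tendsto_zero (hz.tendsto_empMean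
      (ψ := fun v => deriv (deriv G) (v j) * v l) (by fun_prop)
      (hmom.hasMean_deriv_nonlin_mul hs (hz.measurable 0) hjl))
      (hρ.shift_isBigO hΓ j)).trans_isBigO isBigO_augment
  refine ((htaylor.add hrow).add hshift).congr_left fun q => ?_
  have hdel : ∑ m, del P G (fun ω => z 0 ω j) * (1 : Matrix (Fin p) (Fin p) ℝ) m l * dev Γ j m q
      = del P G (fun ω => z 0 ω j) * dev Γ j l q := by
    simp [Matrix.one_apply]
  have hcomm : ∑ m, empMean z (fun v => deriv (deriv G) (v j) * (v m * v l)) q * dev Γ j m q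
      = ∑ m, dev Γ j m q * empMean z (fun v => deriv (deriv G) (v j) * (v m * v l)) q :=
    Finset.sum_congr rfl fun m _ => mul_comm _ _
  simp only [sub_mul _ _ (dev Γ j _ q), Finset.sum_sub_distrib]
  rw [hdel, hcomm]
  simp only [dev]
  ring

theorem isLittleO_sampleT (hρ : IsCommonRate P G z ρ) (hG : ContDiff ℝ 2 G)
    (hx : ∀ i ω, x i ω = loc + z i ω) (hz : IsIIDSample P z) (hs : IsStandardizedSource P (z 0))
    (hmom : HasMoments P G (z 0)) (hdom : LocallyDominated P G (z 0))
    (hΓ : ∀ j m, Tendsto (dev Γ j m) (probFilter P) (𝓝 0)) {j l : Fin p} (hjl : j ≠ l) :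
    (fun q => sampleT G q.1 (fun i => x i q.2) (Γ q j) l - scoreTerm P G z j l q
      - del P G (fun ω => z 0 ω j) * dev Γ j l q) =o[probFilter P] rowScale ρ Γ j := by
  have hcentre : (fun q => (empMean z
      (fun v => deriv G (Γ q j ⬝ᵥ v + shift z (Γ q j) q) * 1) q
        - ∫ ω, deriv G (z 0 ω j) ∂P) * latentMean z q l) =o[probFilter P] rowScale ρ Γ j :=
    (isLittleO_mul_of_tendsto_zero
      (tendsto_sub_nhds_zero_iff.2 (hρ.tendsto_empMean_nonlin_shift hG hz hmom hdom hΓ j))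
      (hρ.mean_isBigO l)).trans_isBigO isBigO_augment
  refine ((hρ.isLittleO_empMean_nonlin hG hz hs hmom hdom hΓ hjl).sub hcentre).congr' ?_
    EventuallyEq.rfl
  filter_upwards [eventually_pos_probFilter] with q hq
  rw [sampleT_apply hx hq, scoreTerm_eq]
  ring

theorem isFirstOrder (hρ : IsCommonRate P G z ρ) (hG : ContDiff ℝ 2 G)
    (hx : ∀ i ω, x i ω = loc + z i ω) (hz : IsIIDSample P z) (hs : IsStandardizedSource P (z 0))
    (hmom : HasMoments P G (z 0)) (hdom : LocallyDominated P G (z 0))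
    (hΓ : ∀ j m, Tendsto (dev Γ j m) (probFilter P) (𝓝 0))
    (hwhite : ∀ᶠ q in probFilter P, IsWhitening q.1 (fun i => x i q.2) (Γ q)) :
    IsFirstOrder (probFilter P) ρ Γ (fun q => sampleCov q.1 fun i => x i q.2)
      (fun q j => sampleT G q.1 (fun i => x i q.2) (Γ q j)) (covTerm z) (scoreTerm P G z)
      (fun k => lam P G fun ω => z 0 ω k) (fun k => del P G fun ω => z 0 ω k) where
  dev_tendsto := hΓ
  rate_tendsto := hρ.tendsto_zero
  cov_symm := covTerm_comm
  cov_isBigO := hρ.cov_isBigO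
  cov := hρ.isLittleO_sampleCov hx
  score_isBigO := hρ.score_isBigO
  score _ _ hjm := hρ.isLittleO_sampleT hG hx hz hs hmom hdom hΓ hjm
  score_tendsto := hρ.tendsto_sampleT hG hx hz hs hmom hdom hΓ
  whitening := hwhite

end IsCommonRate

end SampleExpansion

/-! ### Asymptotic variances -/

section Signs

theorem tendsto_real_sign {A : Type*} {L : Filter A} {f : A → ℝ} {c : ℝ} (hf : Tendsto f L (𝓝 c))
    (hc : c ≠ 0) : Tendsto (fun q => Real.sign (f q)) L (𝓝 (Real.sign c)) := by
  refine tendsto_const_nhds.congr' ?_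
  rcases hc.lt_or_gt with h | h
  · filter_upwards [hf.eventually_lt_const h] with q hq
    rw [Real.sign_of_neg h, Real.sign_of_neg hq]
  · filter_upwards [hf.eventually_const_lt h] with q hq
    rw [Real.sign_of_pos h, Real.sign_of_pos hq]

theorem abs_real_sign_le_one (y : ℝ) : |Real.sign y| ≤ 1 := by
  rcases Real.sign_apply_eq y with h | h | h <;> simp [h]

theorem real_sign_mul_nonneg {y w : ℝ} (h : 0 ≤ y * w) : 0 ≤ Real.sign y * w := by
  rcases lt_trichotomy y 0 with hy | rfl | hy
  · rw [Real.sign_of_neg hy, neg_one_mul, neg_nonneg]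
    exact nonpos_of_mul_nonneg_right h hy
  · simp
  · rw [Real.sign_of_pos hy, one_mul]
    exact nonneg_of_mul_nonneg_right h hy

theorem real_sign_mul_eq_zero_iff {y w : ℝ} : Real.sign y * w = 0 ↔ y * w = 0 := by
  rw [mul_eq_zero, mul_eq_zero, Real.sign_eq_zero_iff]

theorem add_ne_zero_of_nonneg_of_zero_unique {ι : Type*} {f : ι → ℝ} (hf : ∀ k, 0 ≤ f k)
    (hzero : ∀ k m, f k = 0 → f m = 0 → k = m) {k m : ι} (hkm : k ≠ m) : f k + f m ≠ 0 := by
  rw [Ne, add_eq_zero_iff_of_nonneg (hf k) (hf m)]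
  exact fun h => hkm (hzero k m h.1 h.2)

theorem real_sign_mul_add_ne_zero_of_zero_unique {ι : Type*} {y w : ι → ℝ}
    (hyw : ∀ k, 0 ≤ y k * w k) (hzero : ∀ k m, y k * w k = 0 → y m * w m = 0 → k = m) {k m : ι}
    (hkm : k ≠ m) : Real.sign (y k) * w k + Real.sign (y m) * w m ≠ 0 :=
  add_ne_zero_of_nonneg_of_zero_unique (f := fun k => Real.sign (y k) * w k)
    (fun k => real_sign_mul_nonneg (hyw k))
    (fun k m hk hm => hzero k m (real_sign_mul_eq_zero_iff.1 hk) (real_sign_mul_eq_zero_iff.1 hm))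
    hkm

end Signs

section AsymptoticVariance

variable {Ω : Type*} [MeasurableSpace Ω] {P : Measure Ω} {p : ℕ}
  {z x : ℕ → Ω → Fin p → ℝ} {loc : Fin p → ℝ} {G : ℝ → ℝ}
  {Γhat : ℕ → Ω → Matrix (Fin p) (Fin p) ℝ} {j l : Fin p}
  {Eqs : ℕ → (ℕ → Fin p → ℝ) → Matrix (Fin p) (Fin p) ℝ → Prop}

theorem IsConsistentSolution.eventually (h : IsConsistentSolution P Eqs x Γhat) :
    ∀ᶠ q in probFilter P, Eqs q.1 (fun i => x i q.2) (Γhat q.1 q.2) :=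
  eventually_probFilter.2 h.solves

theorem IsConsistentSolution.tendsto_dev (h : IsConsistentSolution P Eqs x Γhat) (j m : Fin p) :
    Tendsto (dev (fun q : ℕ × Ω => Γhat q.1 q.2) j m) (probFilter P) (𝓝 0) := by
  have hΓ := tendstoInMeasure_iff_probFilter.1 (h.consistent j m)
  unfold dev
  exact hΓ

theorem empMean_influence (hjl : j ≠ l) (a b c : ℝ) (q : ℕ × Ω) :
    empMean z (influence P G (z 0) j l a b c) q
      = a * (scoreTerm P G z j l q - lam P G (fun ω => z 0 ω j) * covTerm z j l q)
        + b * (scoreTerm P G z l j q - lam P G (fun ω => z 0 ω l) * covTerm z j l q)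
        + c * covTerm z j l q := by
  simp only [scoreTerm, covTerm, ← empMean_const_mul, ← empMean_sub, ← empMean_add]
  congr 1
  ext v
  simp only [influence, residual, Matrix.one_apply_ne hjl]
  ring

theorem sq_mul_alpha {Y : Ω → ℝ} (hY : lam P G Y ≠ del P G Y) (b : ℝ) :
    (b * (lam P G Y - del P G Y)) ^ 2 * alpha P G Y
      = b ^ 2 * (sigmaSq P G Y - lam P G Y ^ 2) := by
  have := sub_ne_zero.2 hY
  rw [alpha]
  field_simp

variable [IsProbabilityMeasure P]

theorem hasASVSum_of_influence (hz : IsIIDSample P z) (hs : IsStandardizedSource P (z 0))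
    (hmom : HasMoments P G (z 0)) (hm : ∀ n a b, Measurable fun ω => Γhat n ω a b) (hjl : j ≠ l)
    {ρ : ℕ × Ω → ℝ} (hρ : IsCommonRate P G z ρ) {a b c a' b' c' : ℝ}
    (h1 : (fun q => dev (fun q : ℕ × Ω => Γhat q.1 q.2) j l q
      - empMean z (influence P G (z 0) j l a b c) q) =o[probFilter P] ρ)
    (h2 : (fun q => dev (fun q : ℕ × Ω => Γhat q.1 q.2) l j q
      - empMean z (influence P G (z 0) j l a' b' c') q) =o[probFilter P] ρ) :
    HasASVSum P Γhat j l
      ((a ^ 2 + a' ^ 2) * (sigmaSq P G (fun ω => z 0 ω j) - lam P G (fun ω => z 0 ω j) ^ 2)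
        + (b ^ 2 + b' ^ 2) * (sigmaSq P G (fun ω => z 0 ω l) - lam P G (fun ω => z 0 ω l) ^ 2)
        + (c ^ 2 + c' ^ 2)) := by
  have hZ := hz.measurable 0
  refine ⟨_, _, hz.hasASV (measurable_influence a b c) (hmom.memLp_influence hs hZ hjl a b c)
    (hmom.hasMean_influence hs hZ hjl a b c).2 (fun n => hm n j l) (hρ.negligible _ h1),
    hz.hasASV (measurable_influence a' b' c') (hmom.memLp_influence hs hZ hjl a' b' c')
    (hmom.hasMean_influence hs hZ hjl a' b' c').2 (fun n => hm n l j) (hρ.negligible _ h2), ?_⟩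
  rw [Real.coe_toNNReal _ (integral_nonneg fun ω => sq_nonneg _),
    Real.coe_toNNReal _ (integral_nonneg fun ω => sq_nonneg _),
    (hmom.hasMean_influence_sq hs hZ hjl a b c).2, (hmom.hasMean_influence_sq hs hZ hjl a' b' c').2]
  ring

theorem hasASVSum_deflation (hG : ContDiff ℝ 2 G) (hx : ∀ i ω, x i ω = loc + z i ω)
    (hz : IsIIDSample P z) (hs : IsStandardizedSource P (z 0)) (hmom : HasMoments P G (z 0))
    (hdom : LocallyDominated P G (z 0)) (h : IsConsistentSolution P (IsDeflation G) x Γhat)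
    (hjl : j < l) (hne : ∀ k ≤ j, lam P G (fun ω => z 0 ω k) ≠ del P G (fun ω => z 0 ω k)) :
    HasASVSum P Γhat j l
      (weighted 1 0 (alpha P G fun ω => z 0 ω j) (alpha P G fun ω => z 0 ω l)) := by
  obtain ⟨ρ, hρ⟩ := exists_isCommonRate hz hs hmom
  have hF := hρ.isFirstOrder hG hx hz hs hmom hdom h.tendsto_dev
    (h.eventually.mono fun q hq => hq.1)
  have heq := h.eventually.mono fun q hq => hq.2
  set d := lam P G (fun ω => z 0 ω j) - del P G (fun ω => z 0 ω j) with hd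
  have hd0 : d ≠ 0 := sub_ne_zero.2 (hne j le_rfl)
  have hsum := hasASVSum_of_influence hz hs hmom h.measurable hjl.ne hρ
    (a := d⁻¹) (b := 0) (c := 0) (a' := -d⁻¹) (b' := 0) (c' := -1)
    ((hF.isLittleO_deflation heq hjl hne).congr_left fun q => by
      rw [empMean_influence hjl.ne]; ring)
    ((hF.isLittleO_deflation_swap heq hjl hne).congr_left fun q => by
      rw [empMean_influence hjl.ne]; ring)
  convert! hsum using 1
  simp only [weighted, alpha, ← hd]
  field_simp
  ring

/-- Both simultaneous estimates solve the equations `w j γ_lᵀ T(γ_j) = w l γ_jᵀ T(γ_l)`, with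
random weights `w`. -/
theorem hasASVSum_of_weights (hG : ContDiff ℝ 2 G) (hx : ∀ i ω, x i ω = loc + z i ω)
    (hz : IsIIDSample P z) (hs : IsStandardizedSource P (z 0)) (hmom : HasMoments P G (z 0))
    (hdom : LocallyDominated P G (z 0)) (h : IsConsistentSolution P Eqs x Γhat)
    {w : Fin p → ℕ × Ω → ℝ} {β : Fin p → ℝ}
    (hEqs : ∀ᶠ q in probFilter P, IsWhitening q.1 (fun i => x i q.2) (Γhat q.1 q.2) ∧
      ∀ j l, w j q * (Γhat q.1 q.2 l ⬝ᵥ sampleT G q.1 (fun i => x i q.2) (Γhat q.1 q.2 j))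
        = w l q * (Γhat q.1 q.2 j ⬝ᵥ sampleT G q.1 (fun i => x i q.2) (Γhat q.1 q.2 l)))
    (hw : ∀ k, w k =O[probFilter P] fun _ => (1 : ℝ))
    (hβ : ∀ k, Tendsto (fun q => w k q
      * (lam P G (fun ω => z 0 ω k) - del P G (fun ω => z 0 ω k))) (probFilter P) (𝓝 (β k)))
    (hne : ∀ k m, k ≠ m → β k + β m ≠ 0) (hjl : j ≠ l)
    (hj : lam P G (fun ω => z 0 ω j) ≠ del P G (fun ω => z 0 ω j))
    (hl : lam P G (fun ω => z 0 ω l) ≠ del P G (fun ω => z 0 ω l)) :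
    HasASVSum P Γhat j l
      (weighted (β j) (β l) (alpha P G fun ω => z 0 ω j) (alpha P G fun ω => z 0 ω l)) := by
  obtain ⟨ρ, hρ⟩ := exists_isCommonRate hz hs hmom
  have hF := hρ.isFirstOrder hG hx hz hs hmom hdom h.tendsto_dev (hEqs.mono fun q hq => hq.1)
  have heq := hEqs.mono fun q hq => hq.2
  have hlim : ∀ k, lam P G (fun ω => z 0 ω k) ≠ del P G (fun ω => z 0 ω k) →
      ∃ b, Tendsto (w k) (probFilter P) (𝓝 b) ∧
        β k = b * (lam P G (fun ω => z 0 ω k) - del P G (fun ω => z 0 ω k)) := fun k hk => by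
    have hk0 := sub_ne_zero.2 hk
    exact ⟨_, ((hβ k).div_const _).congr fun q => mul_div_cancel_right₀ _ hk0,
      (div_mul_cancel₀ _ hk0).symm⟩
  obtain ⟨b, hb, hbβ⟩ := hlim j hj
  obtain ⟨c, hc, hcβ⟩ := hlim l hl
  have h1 := hF.isLittleO_symmetric hw hβ hne heq hjl hb hc
  have h2 := hF.isLittleO_symmetric hw hβ hne heq hjl.symm hc hb
  rw [add_comm (β l)] at h2
  have hsum := hasASVSum_of_influence hz hs hmom h.measurable hjl hρ
    (a := (β j + β l)⁻¹ * b) (b := -((β j + β l)⁻¹ * c)) (c := -((β j + β l)⁻¹ * β l))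
    (a' := -((β j + β l)⁻¹ * b)) (b' := (β j + β l)⁻¹ * c) (c' := -((β j + β l)⁻¹ * β j))
    (h1.congr_left fun q => by
      rw [empMean_influence hjl]
      linear_combination (-(β j + β l)⁻¹ * covTerm z j l q) * hcβ)
    (h2.congr_left fun q => by
      rw [empMean_influence hjl, covTerm_comm l j]
      linear_combination (-(β j + β l)⁻¹ * covTerm z j l q) * hbβ)
  convert! hsum using 1
  have halphaj := sq_mul_alpha hj b
  have halphal := sq_mul_alpha hl c
  rw [← hbβ] at halphaj
  rw [← hcβ] at halphal
  simp only [weighted, div_eq_mul_inv]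
  linear_combination 2 * ((β j + β l)⁻¹) ^ 2 * (halphaj + halphal)

theorem IsConsistentSolution.tendsto_sampleG (h : IsConsistentSolution P Eqs x Γhat)
    (hG : ContDiff ℝ 2 G) (hx : ∀ i ω, x i ω = loc + z i ω) (hz : IsIIDSample P z)
    (hs : IsStandardizedSource P (z 0)) (hmom : HasMoments P G (z 0))
    (hdom : LocallyDominated P G (z 0)) (k : Fin p) :
    Tendsto (fun q : ℕ × Ω => sampleG G q.1 (fun i => x i q.2) (Γhat q.1 q.2 k)) (probFilter P)
      (𝓝 (nu P G fun ω => z 0 ω k)) :=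
  have ⟨_, hρ⟩ := exists_isCommonRate hz hs hmom
  hρ.tendsto_sampleG hG hx hz hs hmom hdom h.tendsto_dev k

theorem hasASVSum_symmetric (hG : ContDiff ℝ 2 G) (hx : ∀ i ω, x i ω = loc + z i ω)
    (hz : IsIIDSample P z) (hs : IsStandardizedSource P (z 0)) (hmom : HasMoments P G (z 0))
    (hdom : LocallyDominated P G (z 0)) (h : IsConsistentSolution P (IsSymmetric G) x Γhat)
    {β : Fin p → ℝ} (hβ : ∀ k, β k = sgn P G (fun ω => z 0 ω k)
      * (lam P G (fun ω => z 0 ω k) - del P G (fun ω => z 0 ω k)))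
    (hnu : ∀ k, nu P G (fun ω => z 0 ω k) = 0 →
      lam P G (fun ω => z 0 ω k) = del P G (fun ω => z 0 ω k))
    (hne : ∀ k m, k ≠ m → β k + β m ≠ 0) (hjl : j ≠ l)
    (hj : lam P G (fun ω => z 0 ω j) ≠ del P G (fun ω => z 0 ω j))
    (hl : lam P G (fun ω => z 0 ω l) ≠ del P G (fun ω => z 0 ω l)) :
    HasASVSum P Γhat j l
      (weighted (β j) (β l) (alpha P G fun ω => z 0 ω j) (alpha P G fun ω => z 0 ω l)) := by
  refine hasASVSum_of_weights hG hx hz hs hmom hdom h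
    (w := fun k q => Real.sign (sampleG G q.1 (fun i => x i q.2) (Γhat q.1 q.2 k)))
    ?_ (fun k => ?_) (fun k => ?_) hne hjl hj hl
  · filter_upwards [h.eventually] with q hq
    exact ⟨hq.1, fun j l => by simpa only [mul_comm] using hq.2 j l⟩
  · exact IsBigO.of_bound 1 (Eventually.of_forall fun q => by simpa using abs_real_sign_le_one _)
  · rw [hβ]
    by_cases hk : nu P G (fun ω => z 0 ω k) = 0
    · simpa [hnu k hk] using tendsto_const_nhds
    · exact (tendsto_real_sign (h.tendsto_sampleG hG hx hz hs hmom hdom k) hk).mul_const _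

theorem hasASVSum_squaredSymmetric (hG : ContDiff ℝ 2 G) (hx : ∀ i ω, x i ω = loc + z i ω)
    (hz : IsIIDSample P z) (hs : IsStandardizedSource P (z 0)) (hmom : HasMoments P G (z 0))
    (hdom : LocallyDominated P G (z 0)) (h : IsConsistentSolution P (IsSquaredSymmetric G) x Γhat)
    {β : Fin p → ℝ} (hβ : ∀ k, β k = nu P G (fun ω => z 0 ω k)
      * (lam P G (fun ω => z 0 ω k) - del P G (fun ω => z 0 ω k)))
    (hne : ∀ k m, k ≠ m → β k + β m ≠ 0) (hjl : j ≠ l)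
    (hj : lam P G (fun ω => z 0 ω j) ≠ del P G (fun ω => z 0 ω j))
    (hl : lam P G (fun ω => z 0 ω l) ≠ del P G (fun ω => z 0 ω l)) :
    HasASVSum P Γhat j l
      (weighted (β j) (β l) (alpha P G fun ω => z 0 ω j) (alpha P G fun ω => z 0 ω l)) := by
  have hlim := h.tendsto_sampleG hG hx hz hs hmom hdom
  refine hasASVSum_of_weights hG hx hz hs hmom hdom h
    (w := fun k q => sampleG G q.1 (fun i => x i q.2) (Γhat q.1 q.2 k))
    ?_ (fun k => (hlim k).isBigO_one ℝ) (fun k => ?_) hne hjl hj hl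
  · filter_upwards [h.eventually] with q hq
    refine ⟨hq.1, fun j l => ?_⟩
    simpa only [sampleT2, dotProduct_smul, smul_eq_mul] using hq.2 j l
  · rw [hβ]
    exact (hlim k).mul_const _

end AsymptoticVariance

end FastICA

theorem theorem2_general {p : ℕ} {Ω : Type*} [MeasurableSpace Ω] (P : Measure Ω)
    [IsProbabilityMeasure P] (G : ℝ → ℝ) (hG : ContDiff ℝ 2 G)
    (z x : ℕ → Ω → Fin p → ℝ) (loc : Fin p → ℝ) (hx : ∀ i ω, x i ω = loc + z i ω)
    (hiid : IsIIDSample P z) (hsource : IsStandardizedSource P (z 0)) (hmom : HasMoments P G (z 0))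
    (hdom : LocallyDominated P G (z 0))
    (ν lm δ s α : Fin p → ℝ)
    (hν : ∀ k, ν k = nu P G (fun ω => z 0 ω k))
    (hlm : ∀ k, lm k = lam P G (fun ω => z 0 ω k))
    (hδ : ∀ k, δ k = del P G (fun ω => z 0 ω k))
    (hs : ∀ k, s k = sgn P G (fun ω => z 0 ω k))
    (hα : ∀ k, α k = alpha P G (fun ω => z 0 ω k))
    (j l : Fin p) (hjl : j ≠ l) (hj : lm j ≠ δ j) :
    (j < l → (∀ k < j, lm k ≠ δ k) →
      ∀ Γhat, IsConsistentSolution P (IsDeflation G) x Γhat →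
        HasASVSum P Γhat j l (weighted 1 0 (α j) (α l))) ∧
    (lm l ≠ δ l → (∀ k, ν k = 0 → lm k = δ k) →
      (∀ k m, k ≠ m → s k * (lm k - δ k) + s m * (lm m - δ m) ≠ 0) →
      ∀ Γhat, IsConsistentSolution P (IsSymmetric G) x Γhat →
        HasASVSum P Γhat j l
          (weighted (s j * (lm j - δ j)) (s l * (lm l - δ l)) (α j) (α l))) ∧
    (lm l ≠ δ l → (∀ k m, k ≠ m → ν k * (lm k - δ k) + ν m * (lm m - δ m) ≠ 0) →
      ∀ Γhat, IsConsistentSolution P (IsSquaredSymmetric G) x Γhat →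
        HasASVSum P Γhat j l
          (weighted (ν j * (lm j - δ j)) (ν l * (lm l - δ l)) (α j) (α l))) := by
  obtain rfl := funext hν
  obtain rfl := funext hlm
  obtain rfl := funext hδ
  obtain rfl := funext hs
  obtain rfl := funext hα
  refine ⟨fun hlt hk Γhat hΓ => ?_, fun hl hν0 hne Γhat hΓ => ?_, fun hl hne Γhat hΓ => ?_⟩
  · exact hasASVSum_deflation hG hx hiid hsource hmom hdom hΓ hlt fun k hkj =>
      hkj.lt_or_eq.elim (hk k) fun h => h ▸ hj
  · exact hasASVSum_symmetric hG hx hiid hsource hmom hdom hΓ (fun _ => rfl) hν0 hne hjl hj hl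
  · exact hasASVSum_squaredSymmetric hG hx hiid hsource hmom hdom hΓ (fun _ => rfl) hne hjl hj hl

theorem theorem2 {p : ℕ} {Ω : Type*} [MeasurableSpace Ω] (P : Measure Ω) [IsProbabilityMeasure P]
    (G : ℝ → ℝ) (hG : IsContrast G)
    (z x : ℕ → Ω → Fin p → ℝ) (loc : Fin p → ℝ) (hx : ∀ i ω, x i ω = loc + z i ω)
    (hiid : IsIIDSample P z) (hsource : IsSource P (z 0)) (hmom : HasMoments P G (z 0))
    (hdom : LocallyDominated P G (z 0))
    (ν lm δ s α : Fin p → ℝ)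
    (hν : ∀ k, ν k = nu P G (fun ω => z 0 ω k))
    (hlm : ∀ k, lm k = lam P G (fun ω => z 0 ω k))
    (hδ : ∀ k, δ k = del P G (fun ω => z 0 ω k))
    (hs : ∀ k, s k = sgn P G (fun ω => z 0 ω k))
    (hα : ∀ k, α k = alpha P G (fun ω => z 0 ω k))
    (hnonneg : ∀ k, 0 ≤ ν k * (lm k - δ k))
    (hzero : ∀ k k', ν k * (lm k - δ k) = 0 → ν k' * (lm k' - δ k') = 0 → k = k')
    (j l : Fin p) (hjl : j ≠ l)
    (hj : ¬ IsGaussianVar P (fun ω => z 0 ω j)) (hl : ¬ IsGaussianVar P (fun ω => z 0 ω l))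
    (hj0 : ν j * (lm j - δ j) ≠ 0) (hl0 : ν l * (lm l - δ l) ≠ 0) :
    -- deflation-based: component `j` is extracted before component `l`
    (j < l → (∀ k < j, lm k ≠ δ k) →
      ∀ Γhat, IsConsistentSolution P (IsDeflation G) x Γhat →
        HasASVSum P Γhat j l (weighted 1 0 (α j) (α l))) ∧
    -- symmetric
    ((∀ k, ν k = 0 → lm k = δ k) →
      ∀ Γhat, IsConsistentSolution P (IsSymmetric G) x Γhat →
        HasASVSum P Γhat j l
          (weighted (s j * (lm j - δ j)) (s l * (lm l - δ l)) (α j) (α l))) ∧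
    -- squared symmetric
    (∀ Γhat, IsConsistentSolution P (IsSquaredSymmetric G) x Γhat →
        HasASVSum P Γhat j l
          (weighted (ν j * (lm j - δ j)) (ν l * (lm l - δ l)) (α j) (α l))) := by
  obtain ⟨hdeflation, hsymmetric, hsquared⟩ := theorem2_general P G hG.contDiff z x loc hx hiid
    hsource.isStandardizedSource hmom hdom ν lm δ s α hν hlm hδ hs hα j l hjl
    (sub_ne_zero.1 (right_ne_zero_of_mul hj0))
  have hsign : ∀ k, s k = Real.sign (ν k) := fun k => by rw [hs, hν, sgn]
  have hld : lm l ≠ δ l := sub_ne_zero.1 (right_ne_zero_of_mul hl0)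
  refine ⟨hdeflation, fun hν0 => hsymmetric hld hν0 fun k m hkm => ?_,
    hsquared hld fun k m => add_ne_zero_of_nonneg_of_zero_unique hnonneg hzero⟩
  simpa only [hsign] using real_sign_mul_add_ne_zero_of_zero_unique hnonneg hzero hkm
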